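/- Let $n\ge 2$ and $l\ge 1$ be integers with $2l>n$, let $0<2\delta<2l-n$, and put $\gamma_0=2l-n-2\delta$, $Q=[0,2\pi)^n$, $K=[0,1]^n$. For a function $W$ that is $2\pi$-periodic in each variable, let $w_q=(2\pi)^{-n}\int_Q W(x)e^{-i\langle q,x\rangle}dx$ be its Fourier coefficients, $\|W\|_*=\sum_{q\in\mathbb Z^n}|w_q|$, and $\widetilde W=W-w_0$. For $t\in K$ and $j\in\mathbb Z^n$ let $p_j(t)=t+j$ and $\psi_j(x)=e^{i\langle p_j(t),x\rangle}$. For $k>0$ let $\varepsilon(k,\delta)=(k^{2l}-k^{2l-n-\delta},\,k^{2l}+k^{2l-n-\delta})$, and let the non-resonant set $\chi_0(k,\delta)$ consist of all $t\in K$ for which there is $j\in\mathbb Z^n$ with $|p_j(t)|^{2l}=k^{2l}$ and $\big||p_q(t)|^{2l}-k^{2l}\big|>2k^{2l-n-\delta}$ for all $q\ne j$. For a bounded real periodic $W$ let $H_W(t)=(-\Delta)^l+W$ be the operator in $L^2(Q)$ with the quasi-periodic boundary conditions of quasimomentum $t$ (those satisfied by the plane waves $\psi_m$, $m\in\mathbb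 Z^n$), let $E_W(t)$ be its spectral projection for the interval $\varepsilon(k,\delta)$, with matrix elements $E_W(t)_{mj}$ given by $E_W(t)\psi_j=\sum_m E_W(t)_{mj}\psi_m$, and for $A\in\mathbb C$ put $u_W=A\sum_{m\in\mathbb Z^n}E_W(t)_{mj}\psi_m$. For a real potential $V$ and $\sigma\in\mathbb R$ define $\mathcal M W=V+\sigma|u_{\widetilde W}|^2$, $W_0=V+\sigma|A|^2$ and $W_{m+1}=\mathcal M W_m$. **Statement.** For every $M\ge 0$ there is $k_1$, depending only on $n$, $l$, $\delta$ and $M$, such that the following holds for every real, bounded, $2\pi$-periodic $V$ with $\|V\|_*=M$ and $v_0=0$, every $k>k_1$, every $t\in K$ at distance less than $k^{-n+1-2\delta}$ from a point of $\chi_0(k,\delta)$, every $\sigma\in\mathbb R$ and every $A\in\mathbb C$ with $|\sigma||A|^2<k^{\gamma_1}$ for some $\gamma_1<\gamma_0$. There is exactly one $j\in\mathbb Z^n$ with $|p_j(t)|^{2l}\in\varepsilon(k,\delta)$, and with this $j$: 1. the sequence $(W_m)_{m\ge 0}$ is well defined: each $W_m$ is bounded and periodic, $H_{\widetilde W_m}(t)$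 has exactly one eigenvalue in $\varepsilon(k,\delta)$, this eigenvalue is simple, and $\sum_q|E_{\widetilde W_m}(t)_{qj}|<\infty$; 2. $\|W_m-W_{m-1}\|_*\le\big(|\sigma||A|^2k^{-\gamma_0}\big)^m$ for all $m=1,2,\dots$; 3. there is a bounded periodic function $W$ such that $\|W-W_m\|_*\to 0$ as $m\to\infty$, and $\|W-W_m\|_*\le 2\big(|\sigma||A|^2k^{-\gamma_0}\big)^{m+1}$ for all $m=0,1,2,\dots$. -/

import Mathlib

open Set MeasureTheory
open scoped ENNReal NNReal

noncomputable section

namespace Polyharmonic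

/-- `ℝⁿ` with its Euclidean norm. -/
abbrev Space (n : ℕ) := EuclideanSpace ℝ (Fin n)

variable {n : ℕ}

/-! ### The lattice, the cells and the plane waves -/

/-- The elementary cell `Q = [0, 2π)ⁿ`. -/
def cell (n : ℕ) : Set (Space n) := {x | ∀ i, x i ∈ Ico (0 : ℝ) (2 * Real.pi)}

/-- Lebesgue measure on `Q`. -/
abbrev cellMeasure (n : ℕ) : Measure (Space n) := volume.restrict (cell n)

/-- The cell `K = [0, 1]ⁿ` of quasimomenta. -/
def dualCell (n : ℕ) : Set (Space n) := {t | ∀ i, t i ∈ Icc (0 : ℝ) 1}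

/-- `W` is `2π`-periodic in every coordinate. -/
def IsCellPeriodic (W : Space n → ℝ) : Prop :=
  ∀ (x : Space n) (i : Fin n), W (x + EuclideanSpace.single i (2 * Real.pi)) = W x

/-- The vector `p_j(t) = t + j`. -/
def pvec (t : Space n) (j : Fin n → ℤ) : Space n :=
  WithLp.toLp 2 (fun i => t i + (j i : ℝ))

/-- The plane wave `ψ_j(x) = exp (i ⟨p_j(t), x⟩)`. It satisfies the quasi-periodic conditions
`ψ_j(x + 2π eₛ) = exp (2π i tₛ) ψ_j(x)`, with all its derivatives. -/
def planeWave (t : Space n) (j : Fin n → ℤ) (x : Space n) : ℂ :=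
  Complex.exp (Complex.I * ((inner ℝ (pvec t j) x : ℝ) : ℂ))

/-- The coefficient `(2π)⁻ⁿ ∫_Q f conj(ψ_m)` of `f` along `ψ_m`. -/
def blochCoeff (t : Space n) (f : Space n → ℂ) (m : Fin n → ℤ) : ℂ :=
  ((2 * Real.pi : ℝ) : ℂ)⁻¹ ^ n * ∫ x in cell n, f x * starRingEnd ℂ (planeWave t m x)

/-- The Fourier coefficient `w_q = (2π)⁻ⁿ ∫_Q W(x) exp (-i ⟨q, x⟩) dx`. -/
def fourierCoef (W : Space n → ℝ) (q : Fin n → ℤ) : ℂ :=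
  blochCoeff 0 (fun x => (W x : ℂ)) q

/-- The norm `‖W‖_* = ∑_q |w_q|`, with value `∞` if the series diverges. -/
def starNorm (W : Space n → ℝ) : ℝ≥0∞ := ∑' q : Fin n → ℤ, ‖fourierCoef W q‖ₑ

theorem volume_cell_lt_top (n : ℕ) : volume (cell n) < ∞ := by
  refine (Bornology.IsBounded.subset (Metric.isBounded_closedBall (x := (0 : Space n))
    (r := Real.sqrt (∑ _i : Fin n, (2 * Real.pi) ^ 2))) fun x hx => ?_).measure_lt_top
  rw [mem_closedBall_zero_iff, EuclideanSpace.norm_eq]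
  refine Real.sqrt_le_sqrt (Finset.sum_le_sum fun i _ => ?_)
  rw [Real.norm_eq_abs, sq_abs]
  exact pow_le_pow_left₀ (hx i).1 (hx i).2.le 2

instance isFiniteMeasure_cellMeasure (n : ℕ) : IsFiniteMeasure (cellMeasure n) :=
  ⟨by simpa using volume_cell_lt_top n⟩

theorem norm_planeWave (t : Space n) (j : Fin n → ℤ) (x : Space n) : ‖planeWave t j x‖ = 1 := by
  rw [planeWave, mul_comm]
  exact Complex.norm_exp_ofReal_mul_I _

theorem continuous_planeWave (t : Space n) (j : Fin n → ℤ) : Continuous (planeWave t j) := by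
  unfold planeWave
  fun_prop

theorem memLp_planeWave (t : Space n) (j : Fin n → ℤ) :
    MemLp (planeWave t j) 2 (cellMeasure n) :=
  MemLp.of_bound (continuous_planeWave t j).aestronglyMeasurable 1
    (Filter.Eventually.of_forall fun x => (norm_planeWave t j x).le)

/-! ### The Bloch operator `H(t) = (-Δ)ˡ + W` in `L²(Q)` -/

/-- The Hilbert space `L²(Q)`. -/
abbrev L2Cell (n : ℕ) := Lp ℂ 2 (cellMeasure n)

/-- The differential expression `(-Δ)ˡ` on smooth functions. -/
def polyLaplacian (l : ℕ) (φ : Space n → ℂ) : Space n → ℂ :=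
  (fun f : Space n → ℂ => -(Laplacian.laplacian f))^[l] φ

/-- `H(t) u = f` for `u, f ∈ L²(Q)`, where `H(t) = (-Δ)ˡ + W` is the operator in `L²(Q)` with the
quasi-periodic boundary conditions of quasimomentum `t`: the equation holds weakly,
`∫_Q u conj((-Δ)ˡ ψ) + ∫_Q W u conj(ψ) = ∫_Q f conj(ψ)`, for all plane waves `ψ = ψ_m`. These
satisfy the boundary conditions, they form a complete orthogonal system of `L²(Q)`, and they are
the eigenfunctions of the free operator, so that their span is a core of it. -/
def IsBlochImage (l : ℕ) (t : Space n) (W : Space n → ℝ) (u f : L2Cell n) : Prop :=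
  MemLp (fun x => (W x : ℂ) * u x) 2 (cellMeasure n) ∧
    ∀ m : Fin n → ℤ,
      (∫ x in cell n, u x * starRingEnd ℂ (polyLaplacian l (planeWave t m) x)) +
        (∫ x in cell n, (W x : ℂ) * u x * starRingEnd ℂ (planeWave t m x)) =
          ∫ x in cell n, f x * starRingEnd ℂ (planeWave t m x)

theorem laplacian_planeWave (t : Space n) (m : Fin n → ℤ) (c : ℂ) :
    Laplacian.laplacian (fun x => c * planeWave t m x) =
      fun x => -((‖pvec t m‖ ^ 2 : ℝ) : ℂ) * c * planeWave t m x := by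
  have hd : ∀ (c : ℂ) (x v : Space n), fderiv ℝ (fun x => c * planeWave t m x) x v =
      c * (Complex.I * ((inner ℝ (pvec t m) v : ℝ) : ℂ)) * planeWave t m x := by
    intro c x v
    have h1 : HasFDerivAt (fun x : Space n => ((inner ℝ (pvec t m) x : ℝ) : ℂ))
        (Complex.ofRealCLM.comp (innerSL ℝ (pvec t m))) x :=
      (Complex.ofRealCLM.comp (innerSL ℝ (pvec t m))).hasFDerivAt
    have h2 := (((h1.const_mul Complex.I).cexp).const_mul c).fderiv
    have h3 : (fun x => c * planeWave t m x) =
        fun x => c * Complex.exp (Complex.I * ((inner ℝ (pvec t m) x : ℝ) : ℂ)) := rfl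
    rw [h3, h2]
    simp [planeWave]
    ring
  have hs : ContDiff ℝ 2 (fun x => c * planeWave t m x) := by
    have h1 : ContDiff ℝ 2 (fun x : Space n => ((inner ℝ (pvec t m) x : ℝ) : ℂ)) :=
      (Complex.ofRealCLM.comp (innerSL ℝ (pvec t m))).contDiff
    exact contDiff_const.mul ((contDiff_const.mul h1).cexp)
  rw [InnerProductSpace.laplacian_eq_iteratedFDeriv_orthonormalBasis _
    (EuclideanSpace.basisFun (Fin n) ℝ)]
  funext x
  have h2 : ∀ i : Fin n, iteratedFDeriv ℝ 2 (fun x => c * planeWave t m x) x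
      ![EuclideanSpace.basisFun (Fin n) ℝ i, EuclideanSpace.basisFun (Fin n) ℝ i] =
      -((((pvec t m) i) ^ 2 : ℝ) : ℂ) * c * planeWave t m x := by
    intro i
    set v := EuclideanSpace.basisFun (Fin n) ℝ i with hv
    rw [iteratedFDeriv_two_apply]
    simp only [Matrix.cons_val_zero, Matrix.cons_val_one]
    have h4 : DifferentiableAt ℝ (fderiv ℝ (fun x => c * planeWave t m x)) x :=
      ((hs.fderiv_right (m := 1) (by norm_num)).differentiable (by norm_num)) x
    have h5 : fderiv ℝ (fderiv ℝ (fun x => c * planeWave t m x)) x v v =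
        fderiv ℝ (fun y => fderiv ℝ (fun x => c * planeWave t m x) y v) x v := by
      rw [fderiv_clm_apply h4 (differentiableAt_const _)]
      simp
    rw [h5]
    simp only [hd]
    have h6 : inner ℝ (pvec t m) v = (pvec t m) i := by
      rw [hv, real_inner_comm, EuclideanSpace.basisFun_apply]
      simp [EuclideanSpace.inner_single_left]
    rw [h6]
    push_cast
    linear_combination (c * ((pvec t m).ofLp i : ℂ) ^ 2 * planeWave t m x) * Complex.I_sq
  simp only [h2]
  rw [EuclideanSpace.real_norm_sq_eq, ← Finset.sum_mul, ← Finset.sum_mul]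
  push_cast
  rw [Finset.sum_neg_distrib]

/-- The plane waves are eigenfunctions of `(-Δ)ˡ`, with eigenvalues `|p_m(t)|²ˡ`. -/
theorem polyLaplacian_planeWave (l : ℕ) (t : Space n) (m : Fin n → ℤ) :
    polyLaplacian l (planeWave t m) =
      fun x => ((‖pvec t m‖ ^ (2 * l) : ℝ) : ℂ) * planeWave t m x := by
  unfold polyLaplacian
  induction l with
  | zero => simp
  | succ l ih =>
    rw [Function.iterate_succ_apply', ih, laplacian_planeWave]
    funext x
    simp only [Pi.neg_apply]
    push_cast
    ring

theorem integrable_mul_conj_planeWave {u : Space n → ℂ} (hu : MemLp u 2 (cellMeasure n))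
    (t : Space n) (m : Fin n → ℤ) :
    Integrable (fun x => u x * starRingEnd ℂ (planeWave t m x)) (cellMeasure n) := by
  refine (hu.integrable one_le_two).mul_bdd (c := 1)
    (Complex.continuous_conj.comp (continuous_planeWave t m)).aestronglyMeasurable
    (Filter.Eventually.of_forall fun x => ?_)
  simp [norm_planeWave]

theorem integrable_mul_conj_polyLaplacian {u : Space n → ℂ} (hu : MemLp u 2 (cellMeasure n))
    (l : ℕ) (t : Space n) (m : Fin n → ℤ) :
    Integrable (fun x => u x * starRingEnd ℂ (polyLaplacian l (planeWave t m) x))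
      (cellMeasure n) := by
  rw [polyLaplacian_planeWave]
  refine ((integrable_mul_conj_planeWave hu t m).const_mul
    ((‖pvec t m‖ ^ (2 * l) : ℝ) : ℂ)).congr (Filter.Eventually.of_forall fun x => ?_)
  simp only [map_mul, Complex.conj_ofReal]
  ring

theorem IsBlochImage.add {l : ℕ} {t : Space n} {W : Space n → ℝ} {u v f g : L2Cell n}
    (hu : IsBlochImage l t W u f) (hv : IsBlochImage l t W v g) :
    IsBlochImage l t W (u + v) (f + g) := by
  have ha : ∀ a b : L2Cell n, ∀ h : Space n → ℂ, (fun x => (a + b : L2Cell n) x * h x)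
      =ᵐ[cellMeasure n] fun x => a x * h x + b x * h x := fun a b h => by
    filter_upwards [Lp.coeFn_add a b] with x hx
    rw [hx, Pi.add_apply, add_mul]
  have hW : (fun x => (W x : ℂ) * (u + v : L2Cell n) x) =ᵐ[cellMeasure n]
      fun x => (W x : ℂ) * u x + (W x : ℂ) * v x := by
    filter_upwards [Lp.coeFn_add u v] with x hx
    rw [hx, Pi.add_apply, mul_add]
  refine ⟨(memLp_congr_ae hW).2 (hu.1.add hv.1), fun m => ?_⟩
  have hW' : (fun x => (W x : ℂ) * (u + v : L2Cell n) x * starRingEnd ℂ (planeWave t m x))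
      =ᵐ[cellMeasure n] fun x => (W x : ℂ) * u x * starRingEnd ℂ (planeWave t m x) +
        (W x : ℂ) * v x * starRingEnd ℂ (planeWave t m x) := by
    filter_upwards [hW] with x hx
    rw [hx, add_mul]
  rw [integral_congr_ae (ha u v _), integral_congr_ae (ha f g _), integral_congr_ae hW',
    integral_add (integrable_mul_conj_polyLaplacian (Lp.memLp u) l t m)
      (integrable_mul_conj_polyLaplacian (Lp.memLp v) l t m),
    integral_add (integrable_mul_conj_planeWave hu.1 t m)
      (integrable_mul_conj_planeWave hv.1 t m),
    integral_add (integrable_mul_conj_planeWave (Lp.memLp f) t m)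
      (integrable_mul_conj_planeWave (Lp.memLp g) t m), ← hu.2 m, ← hv.2 m]
  ring

theorem IsBlochImage.smul {l : ℕ} {t : Space n} {W : Space n → ℝ} {u f : L2Cell n} (c : ℂ)
    (hu : IsBlochImage l t W u f) : IsBlochImage l t W (c • u) (c • f) := by
  have ha : ∀ a : L2Cell n, ∀ h : Space n → ℂ, (fun x => (c • a : L2Cell n) x * h x)
      =ᵐ[cellMeasure n] fun x => c * (a x * h x) := fun a h => by
    filter_upwards [Lp.coeFn_smul c a] with x hx
    rw [hx, Pi.smul_apply, smul_eq_mul, mul_assoc]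
  have hW : (fun x => (W x : ℂ) * (c • u : L2Cell n) x) =ᵐ[cellMeasure n]
      fun x => c * ((W x : ℂ) * u x) := by
    filter_upwards [Lp.coeFn_smul c u] with x hx
    rw [hx, Pi.smul_apply, smul_eq_mul]
    ring
  refine ⟨(memLp_congr_ae hW).2 (hu.1.const_mul c), fun m => ?_⟩
  have hW' : (fun x => (W x : ℂ) * (c • u : L2Cell n) x * starRingEnd ℂ (planeWave t m x))
      =ᵐ[cellMeasure n] fun x => c * ((W x : ℂ) * u x * starRingEnd ℂ (planeWave t m x)) := by
    filter_upwards [hW] with x hx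
    rw [hx, mul_assoc]
  rw [integral_congr_ae (ha u _), integral_congr_ae (ha f _), integral_congr_ae hW',
    integral_const_mul, integral_const_mul, integral_const_mul, ← hu.2 m]
  ring

/-- The eigenspace `ker (H(t) - lam)` in `L²(Q)`. -/
def blochEigenspace (l : ℕ) (t : Space n) (W : Space n → ℝ) (lam : ℝ) :
    Submodule ℂ (L2Cell n) where
  carrier := {u | IsBlochImage l t W u ((lam : ℂ) • u)}
  zero_mem' := by
    have h0 : (fun x => (W x : ℂ) * ((0 : L2Cell n) : Space n → ℂ) x) =ᵐ[cellMeasure n] 0 := by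
      filter_upwards [Lp.coeFn_zero ℂ 2 (cellMeasure n)] with x hx
      rw [hx, Pi.zero_apply, mul_zero]
    have h1 : ∀ h : Space n → ℂ, ∫ x in cell n, ((0 : L2Cell n) : Space n → ℂ) x * h x = 0 := by
      refine fun h => integral_eq_zero_of_ae ?_
      filter_upwards [Lp.coeFn_zero ℂ 2 (cellMeasure n)] with x hx
      rw [hx, Pi.zero_apply, zero_mul]
    refine ⟨(memLp_congr_ae h0).2 MemLp.zero, fun m => ?_⟩
    rw [smul_zero, h1, h1, zero_add]
    refine integral_eq_zero_of_ae ?_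
    filter_upwards [h0] with x hx
    rw [hx, Pi.zero_apply, zero_mul]
  add_mem' := fun {u v} hu hv => by
    have h := IsBlochImage.add hu hv
    rwa [← smul_add] at h
  smul_mem' := fun c u hu => by
    have h := IsBlochImage.smul c hu
    rwa [smul_comm] at h

/-- The interval `ε(k, δ) = (k²ˡ - k^(2l-n-δ), k²ˡ + k^(2l-n-δ))`. -/
def energyWindow (n l : ℕ) (k δ : ℝ) : Set ℝ :=
  Ioo (k ^ (2 * l) - k ^ (2 * (l : ℝ) - n - δ)) (k ^ (2 * l) + k ^ (2 * (l : ℝ) - n - δ))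

/-- `H(t)` has exactly one eigenvalue in `ε(k, δ)`, and that eigenvalue is simple. -/
def HasUniqueSimpleEigenvalue (l : ℕ) (k δ : ℝ) (t : Space n) (W : Space n → ℝ) : Prop :=
  ∃ lam ∈ energyWindow n l k δ, Module.finrank ℂ (blochEigenspace l t W lam) = 1 ∧
    ∀ μ ∈ energyWindow n l k δ, blochEigenspace l t W μ ≠ ⊥ → μ = lam

/-- The closed span of the eigenfunctions of `H(t)` with eigenvalue in `ε(k, δ)`. -/
def spectralSubspace (l : ℕ) (k δ : ℝ) (t : Space n) (W : Space n → ℝ) :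
    Submodule ℂ (L2Cell n) :=
  (⨆ lam ∈ energyWindow n l k δ, blochEigenspace l t W lam).topologicalClosure

/-- The spectral projection `E(t)` of `H(t)` for the interval `ε(k, δ)`. If `H(t)` has a unique
simple eigenvalue there, this is the orthogonal projection onto its eigenspace. -/
def spectralProjection (l : ℕ) (k δ : ℝ) (t : Space n) (W : Space n → ℝ) :
    L2Cell n →L[ℂ] L2Cell n :=
  haveI : CompleteSpace (spectralSubspace l k δ t W) :=
    Submodule.topologicalClosure.completeSpace _
  (spectralSubspace l k δ t W).starProjection

/-- The matrix element `E(t)_{mj}` of the spectral projection in the system of plane waves: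
`E(t) ψ_j = ∑_m E(t)_{mj} ψ_m`. -/
def projMatrix (l : ℕ) (k δ : ℝ) (t : Space n) (W : Space n → ℝ) (m j : Fin n → ℤ) : ℂ :=
  blochCoeff t (spectralProjection l k δ t W ((memLp_planeWave t j).toLp (planeWave t j))) m

/-- The Bloch eigenfunction `u_W = A E(t) ψ_j = A ∑_m E(t)_{mj} ψ_m`, as a function on `ℝⁿ`. -/
def blochFunction (l : ℕ) (k δ : ℝ) (t : Space n) (j : Fin n → ℤ) (A : ℂ) (W : Space n → ℝ)
    (x : Space n) : ℂ :=
  A * ∑' m : Fin n → ℤ, projMatrix l k δ t W m j * planeWave t m x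

/-! ### The non-resonant set -/

/-- The isoenergetic surface `S₀(k)` of the free operator, packed into `K`. -/
def isoenergeticSurface (n l : ℕ) (k : ℝ) : Set (Space n) :=
  {t | t ∈ dualCell n ∧ ∃ j, ‖pvec t j‖ ^ (2 * l) = k ^ (2 * l)}

/-- The non-resonant set `χ₀(k, δ)`: the points of `S₀(k)` at which all the other free eigenvalues
are farther than `2 k^(2l-n-δ)` from `k²ˡ`. -/
def nonresonantSet (n l : ℕ) (k δ : ℝ) : Set (Space n) :=
  {t | t ∈ isoenergeticSurface n l k ∧ ∃ j, ‖pvec t j‖ ^ (2 * l) = k ^ (2 * l) ∧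
    ∀ q, q ≠ j → 2 * k ^ (2 * (l : ℝ) - n - δ) < |‖pvec t q‖ ^ (2 * l) - k ^ (2 * l)|}

/-- The `k^(-n+1-2δ)`-neighbourhood in `K` of the non-resonant set. -/
def nonresonantNhd (n l : ℕ) (k δ : ℝ) : Set (Space n) :=
  dualCell n ∩ Metric.thickening (k ^ (-(n : ℝ) + 1 - 2 * δ)) (nonresonantSet n l k δ)

/-! ### The nonlinear map and its iterates -/

/-- The shift `W̃ = W - (2π)⁻ⁿ ∫_Q W` of `W`, with mean value zero. -/
def zeroMean (W : Space n → ℝ) : Space n → ℝ :=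
  fun x => W x - ((2 * Real.pi) ^ n)⁻¹ * ∫ y in cell n, W y

/-- The map `𝓜 W = V + σ |u_{W̃}|²`. -/
def nonlinearMap (l : ℕ) (k δ : ℝ) (t : Space n) (j : Fin n → ℤ) (V : Space n → ℝ) (σ : ℝ) (A : ℂ)
    (W : Space n → ℝ) : Space n → ℝ :=
  fun x => V x + σ * ‖blochFunction l k δ t j A (zeroMean W) x‖ ^ 2

/-- The iterates `W₀ = V + σ |A|²`, `W_{m+1} = 𝓜 W_m`. -/
def iterateW (l : ℕ) (k δ : ℝ) (t : Space n) (j : Fin n → ℤ) (V : Space n → ℝ) (σ : ℝ) (A : ℂ)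
    (m : ℕ) : Space n → ℝ :=
  (nonlinearMap l k δ t j V σ A)^[m] (fun x => V x + σ * ‖A‖ ^ 2)

end Polyharmonic

end

noncomputable section

namespace Polyharmonic

variable {n : ℕ}

section

/-! ### Fourier series on the cell, transferred from the torus -/

-- Everything is moved to `ℓ¹(ℤⁿ)`. In plane-wave coordinates `H(t)` is a diagonal matrix with
-- entries `D_m = |p_m(t)|²ˡ` plus convolution with the Fourier coefficients `w` of the potential
-- (`mem_blochEigenspace_iff`). Near the non-resonant set exactly one level `D_j` lies in the
-- window, with a gap of order `b = k^(2l-n-δ)` to the others (`exists_isIsolatedLevel`).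
--
-- If `64‖w‖ ≤ b`, the eigenvector normalized by `f_j = 1` is the fixed point of a contraction of
-- the ball of radius 2 in `ℓ¹`, and it is Lipschitz in `w` with constant `8/b`
-- (`norm_stateMap_sub_le`, `IsState.norm_sub_le`). Hermitian symmetry of `w` makes the energy real.
-- A sup-norm halving argument shows that every bounded eigenvector with eigenvalue in the window is
-- a multiple of `f` (`IsState.eq_smul_of_eigen`). So the spectral projection has rank one and its
-- `j`-th column is `f_m / ∑|f_q|²` (`IsPerturbation.projMatrix_eq`), Lipschitz in `w` with constant
-- `72/b`.
--
-- Each `W_m` is `V + σ|A ∑ a_q ψ_q|²` for a column `a`, and `W_0` corresponds to `a = e_j` since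
-- `|ψ_j| = 1` (`iterateW_eq_wavePotential`). With `s = σ|A|²`, the potential is `4|s|`-Lipschitz in
-- `a`, so the iteration on columns contracts with factor `4|s|·72/b`. Since `k^(-γ₀) = k^δ/b`, this
-- is at most half of `r = |σ||A|²k^(-γ₀)` once `k^δ` exceeds a constant depending on `M`. The
-- mean-free parts of the potentials stay in the ball of radius `M + 1`, so the perturbation theory
-- applies at every step, and summing a geometric series gives the limit (`iterateW_converges`).

local instance instUnitCircleMeasureSpace : MeasureSpace UnitAddCircle :=
  ⟨AddCircle.haarAddCircle⟩

local instance instUnitCircleIsProbability :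
    IsProbabilityMeasure (volume : Measure UnitAddCircle) :=
  inferInstanceAs (IsProbabilityMeasure AddCircle.haarAddCircle)

/-- The projection of `ℝⁿ` onto the torus `(ℝ / 2πℤ)ⁿ`, rescaled to unit period. -/
def toTorus (n : ℕ) (x : Space n) : UnitAddTorus (Fin n) :=
  fun i => ((x i / (2 * Real.pi) : ℝ) : UnitAddCircle)

/-- The section of `toTorus` with values in the cell. -/
def ofTorus (n : ℕ) (y : UnitAddTorus (Fin n)) : Space n :=
  WithLp.toLp 2 fun i => 2 * Real.pi * (AddCircle.equivIco 1 0 (y i) : ℝ)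

theorem measurableSet_cell (n : ℕ) : MeasurableSet (cell n) := by
  have : cell n = ⋂ i, (fun x : Space n => x i) ⁻¹' Ico (0 : ℝ) (2 * Real.pi) := by
    ext x; simp [cell]
  rw [this]
  exact MeasurableSet.iInter fun i => measurableSet_Ico.preimage (by fun_prop)

theorem measurable_toTorus (n : ℕ) : Measurable (toTorus n) :=
  measurable_pi_lambda _ fun i => AddCircle.measurable_mk'.comp (by fun_prop)

theorem measurable_ofTorus (n : ℕ) : Measurable (ofTorus n) := by
  refine (MeasurableEquiv.toLp 2 (Fin n → ℝ)).measurable.comp (measurable_pi_lambda _ fun i => ?_)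
  exact ((measurable_subtype_coe.comp
    (AddCircle.measurableEquivIco 1 0).measurable).comp (measurable_pi_apply i)).const_mul _

theorem ofTorus_toTorus {x : Space n} (hx : x ∈ cell n) : ofTorus n (toTorus n x) = x := by
  ext i
  have h2 : (0 : ℝ) < 2 * Real.pi := by positivity
  have hm : x i / (2 * Real.pi) ∈ Ico (0 : ℝ) (0 + 1) := by
    refine ⟨div_nonneg (hx i).1 h2.le, ?_⟩
    rw [zero_add, div_lt_one h2]
    exact (hx i).2
  simp only [ofTorus, toTorus]
  rw [AddCircle.equivIco_coe_eq hm]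
  field_simp

/-- The circle carries its probability measure, so the length of `[0, 2π)` appears as a factor. -/
theorem map_mk_div_two_pi :
    (volume.restrict (Ico (0 : ℝ) (2 * Real.pi))).map
      (fun s : ℝ => ((s / (2 * Real.pi) : ℝ) : UnitAddCircle)) =
      ENNReal.ofReal (2 * Real.pi) • (volume : Measure UnitAddCircle) := by
  have h2 : (0 : ℝ) < 2 * Real.pi := by positivity
  have h1 : (volume : Measure UnitAddCircle) =
      (volume.restrict (Ioc (0 : ℝ) (0 + 1))).map ((↑) : ℝ → UnitAddCircle) := by
    rw [(AddCircle.measurePreserving_mk 1 0).map_eq]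
    simp [volume, AddCircle.haarAddCircle]
  have hpre : (fun s : ℝ => s * (2 * Real.pi)⁻¹) ⁻¹' Ico 0 1 = Ico 0 (2 * Real.pi) := by
    ext s
    simp only [mem_preimage, mem_Ico, ← div_eq_mul_inv, div_lt_one h2]
    constructor
    · rintro ⟨ha, hb⟩
      exact ⟨by simpa using (le_div_iff₀ h2).1 ha, hb⟩
    · rintro ⟨ha, hb⟩
      exact ⟨div_nonneg ha h2.le, hb⟩
  have h3 := Real.map_volume_mul_right (a := (2 * Real.pi)⁻¹) (by positivity)
  rw [inv_inv, abs_of_pos h2] at h3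
  have hm : Measurable fun s : ℝ => s * (2 * Real.pi)⁻¹ := by fun_prop
  rw [h1, zero_add, ← restrict_Ico_eq_restrict_Ioc, ← Measure.map_smul,
    ← Measure.restrict_smul, ← h3, Measure.restrict_map hm measurableSet_Ico, hpre,
    Measure.map_map AddCircle.measurable_mk' hm]
  rfl

theorem map_toTorus (n : ℕ) : (cellMeasure n).map (toTorus n) =
    ENNReal.ofReal (2 * Real.pi) ^ n • (volume : Measure (UnitAddTorus (Fin n))) := by
  have hcell : cell n =
      (WithLp.ofLp : Space n → Fin n → ℝ) ⁻¹' univ.pi fun _ => Ico (0 : ℝ) (2 * Real.pi) := by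
    ext x; simp [cell]
  have hof : Measurable (WithLp.ofLp : Space n → Fin n → ℝ) :=
    (PiLp.volume_preserving_ofLp (Fin n)).measurable
  have h1 : toTorus n = (fun (x : Fin n → ℝ) i => ((x i / (2 * Real.pi) : ℝ) : UnitAddCircle)) ∘
      (WithLp.ofLp : Space n → Fin n → ℝ) := rfl
  have hf : Measurable fun s : ℝ => ((s / (2 * Real.pi) : ℝ) : UnitAddCircle) :=
    AddCircle.measurable_mk'.comp (by fun_prop)
  have hp : MeasurableSet (univ.pi fun _ : Fin n => Ico (0 : ℝ) (2 * Real.pi)) :=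
    MeasurableSet.univ_pi fun _ => measurableSet_Ico
  have hg : Measurable
      fun (x : Fin n → ℝ) (i : Fin n) => ((x i / (2 * Real.pi) : ℝ) : UnitAddCircle) :=
    measurable_pi_lambda _ fun i => hf.comp (measurable_pi_apply i)
  rw [h1, ← Measure.map_map hg hof, cellMeasure, hcell, ← Measure.restrict_map hof hp, (PiLp.volume_preserving_ofLp (Fin n)).map_eq,
    volume_pi, Measure.restrict_pi_pi]
  have hs : SigmaFinite ((volume.restrict (Ico (0 : ℝ) (2 * Real.pi))).map
      (fun s : ℝ => ((s / (2 * Real.pi) : ℝ) : UnitAddCircle))) := inferInstance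
  rw [Measure.pi_map_pi fun _ => hf.aemeasurable]
  refine Measure.pi_eq fun s _ => ?_
  simp only [map_mk_div_two_pi, Measure.smul_apply, volume_pi, Measure.pi_pi, smul_eq_mul,
    Finset.prod_mul_distrib, Finset.prod_const, Finset.card_univ, Fintype.card_fin]

theorem integral_comp_toTorus {g : UnitAddTorus (Fin n) → ℂ} (hg : StronglyMeasurable g) :
    ∫ x in cell n, g (toTorus n x) = ((2 * Real.pi : ℝ) : ℂ) ^ n * ∫ y, g y := by
  have h := integral_map (μ := cellMeasure n) (measurable_toTorus n).aemeasurable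
    hg.aestronglyMeasurable
  rw [← h, map_toTorus, integral_smul_measure, ENNReal.toReal_pow,
    ENNReal.toReal_ofReal (by positivity), Complex.real_smul]
  push_cast
  rfl

/-- The quasimomentum enters only through the unimodular factor `planeWave t 0`, which reduces the
system `ψ_m` to the characters of the torus. -/
theorem planeWave_eq_mul_mFourier (t : Space n) (m : Fin n → ℤ) (x : Space n) :
    planeWave t m x = planeWave t 0 x * UnitAddTorus.mFourier m (toTorus n x) := by
  simp only [planeWave, UnitAddTorus.mFourier, ContinuousMap.coe_mk, toTorus, fourier_coe_apply,
    ← Complex.exp_sum, ← Complex.exp_add]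
  congr 1
  have hpi : (Real.pi : ℂ) ≠ 0 := by exact_mod_cast Real.pi_ne_zero
  have : ∀ i, 2 * (Real.pi : ℂ) * Complex.I * (m i) * ((x i / (2 * Real.pi) : ℝ) : ℂ) / (1 : ℝ) =
      Complex.I * ((m i : ℂ) * (x i : ℂ)) := by
    intro i; push_cast; field_simp
  simp only [this, ← Finset.mul_sum]
  rw [← mul_add]
  congr 1
  simp only [pvec, PiLp.inner_apply, Pi.zero_apply, Int.cast_zero, add_zero]
  push_cast
  rw [← Finset.sum_add_distrib]
  refine Finset.sum_congr rfl fun i _ => ?_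
  simp
  ring

theorem planeWave_add (t s : Space n) (p q : Fin n → ℤ) (x : Space n) :
    planeWave t p x * planeWave s q x = planeWave (t + s) (p + q) x := by
  rw [planeWave, planeWave, planeWave, ← Complex.exp_add, ← mul_add, ← Complex.ofReal_add,
    ← inner_add_left]
  congr 5
  ext i
  simp [pvec]
  ring

theorem conj_planeWave (t : Space n) (p : Fin n → ℤ) (x : Space n) :
    starRingEnd ℂ (planeWave t p x) = planeWave (-t) (-p) x := by
  rw [planeWave, planeWave, ← Complex.exp_conj, map_mul, Complex.conj_I, Complex.conj_ofReal]
  have : pvec (-t) (-p) = -pvec t p := by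
    ext i; simp [pvec]; ring
  rw [this, inner_neg_left]
  push_cast
  ring_nf

theorem planeWave_mul_conj (t : Space n) (p q : Fin n → ℤ) (x : Space n) :
    planeWave t p x * starRingEnd ℂ (planeWave t q x) = planeWave 0 (p - q) x := by
  rw [conj_planeWave, planeWave_add, add_neg_cancel, sub_eq_add_neg]

theorem planeWave_zero_zero (x : Space n) : planeWave 0 0 x = 1 := by
  have : pvec (0 : Space n) 0 = 0 := by ext i; simp [pvec]
  simp [planeWave, this]

theorem planeWave_zero_eq_mFourier (m : Fin n → ℤ) (x : Space n) :
    planeWave 0 m x = UnitAddTorus.mFourier m (toTorus n x) := by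
  rw [planeWave_eq_mul_mFourier, planeWave_zero_zero, one_mul]

theorem integral_planeWave_zero (m : Fin n → ℤ) :
    ∫ x in cell n, planeWave 0 m x = if m = 0 then ((2 * Real.pi : ℝ) : ℂ) ^ n else 0 := by
  simp only [planeWave_zero_eq_mFourier]
  rw [integral_comp_toTorus (UnitAddTorus.mFourier m).continuous.stronglyMeasurable]
  have h := orthonormal_iff_ite.1 (UnitAddTorus.orthonormal_mFourier (d := Fin n)) 0 m
  rw [ContinuousMap.inner_toLp] at h
  simp only [UnitAddTorus.mFourier_zero, ContinuousMap.one_apply, map_one, mul_one] at h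
  rw [h]
  simp [eq_comm]

theorem blochCoeff_planeWave (t : Space n) (j m : Fin n → ℤ) :
    blochCoeff t (planeWave t j) m = if m = j then 1 else 0 := by
  have h2 : ((2 * Real.pi : ℝ) : ℂ) ^ n ≠ 0 :=
    pow_ne_zero _ (Complex.ofReal_ne_zero.2 (by positivity))
  rw [blochCoeff]
  simp only [planeWave_mul_conj]
  rw [integral_planeWave_zero]
  by_cases h : m = j
  · simp only [h, sub_self, if_true]
    rw [inv_pow, inv_mul_cancel₀ h2]
  · rw [if_neg h, if_neg fun h' => h (sub_eq_zero.1 h').symm, mul_zero]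

/-- The plane waves form a complete system in `L²(Q)`. -/
theorem ae_eq_zero_of_blochCoeff_eq_zero {u : Space n → ℂ} (hu : MemLp u 2 (cellMeasure n))
    (t : Space n) (h : ∀ m, blochCoeff t u m = 0) : u =ᵐ[cellMeasure n] 0 := by
  have h2 : ((2 * Real.pi : ℝ) : ℂ) ≠ 0 := Complex.ofReal_ne_zero.2 (by positivity)
  obtain ⟨u', hu', huu'⟩ := hu.1
  have hpm : StronglyMeasurable (planeWave t 0 : Space n → ℂ) :=
    (continuous_planeWave t 0).stronglyMeasurable
  -- Removing the factor `ψ_0` turns the coefficients of `u` along `ψ_m` into Fourier coefficients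
  -- on the torus, where the characters form a Hilbert basis.
  set w : Space n → ℂ := fun x => u' x * starRingEnd ℂ (planeWave t 0 x) with hw
  have hwm : StronglyMeasurable w :=
    hu'.mul (Complex.continuous_conj.comp_stronglyMeasurable hpm)
  have hwL : MemLp w 2 (cellMeasure n) := by
    refine ((memLp_congr_ae huu').1 hu).congr_norm hwm.aestronglyMeasurable
      (Filter.Eventually.of_forall fun x => ?_)
    simp [hw, norm_planeWave]
  set v : UnitAddTorus (Fin n) → ℂ := fun y => w (ofTorus n y) with hv
  have hvm : StronglyMeasurable v := hwm.comp_measurable (measurable_ofTorus n)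
  have hvw : ∀ x ∈ cell n, v (toTorus n x) = w x := fun x hx => by
    simp only [hv, ofTorus_toTorus hx]
  have hvw' : v ∘ toTorus n =ᵐ[cellMeasure n] w :=
    (ae_restrict_mem (measurableSet_cell n)).mono hvw
  have hc0 : ENNReal.ofReal (2 * Real.pi) ^ n ≠ 0 :=
    pow_ne_zero _ (by simpa using Real.pi_pos)
  have hvL : MemLp v 2 (volume : Measure (UnitAddTorus (Fin n))) := by
    have h1 : MemLp v 2 ((cellMeasure n).map (toTorus n)) :=
      (memLp_map_measure_iff hvm.aestronglyMeasurable (measurable_toTorus n).aemeasurable).2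
        ((memLp_congr_ae hvw').2 hwL)
    rw [map_toTorus] at h1
    have h3 := h1.smul_measure (c := (ENNReal.ofReal (2 * Real.pi) ^ n)⁻¹) (by simpa using hc0)
    rwa [smul_smul, ENNReal.inv_mul_cancel hc0 (by finiteness), one_smul] at h3
  have hcoef : ∀ m, UnitAddTorus.mFourierCoeff (hvL.toLp v) m = 0 := by
    intro m
    have h1 : UnitAddTorus.mFourierCoeff (hvL.toLp v) m =
        ∫ y, UnitAddTorus.mFourier (-m) y * v y := by
      refine integral_congr_ae ?_
      filter_upwards [hvL.coeFn_toLp] with y hy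
      rw [hy, smul_eq_mul]
    have h3 := integral_comp_toTorus
      ((UnitAddTorus.mFourier (-m)).continuous.stronglyMeasurable.mul hvm)
    have h4 : ∫ x in cell n, ((UnitAddTorus.mFourier (-m) : UnitAddTorus (Fin n) → ℂ) * v)
        (toTorus n x) = ∫ x in cell n, u x * starRingEnd ℂ (planeWave t m x) := by
      refine integral_congr_ae ?_
      filter_upwards [huu', ae_restrict_mem (measurableSet_cell n)] with x hx hxc
      rw [Pi.mul_apply, hvw x hxc, planeWave_eq_mul_mFourier t m, map_mul, hx, hw,
        UnitAddTorus.mFourier_neg]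
      ring
    have h5 := h m
    rw [blochCoeff, mul_eq_zero, or_iff_right (pow_ne_zero _ (inv_ne_zero h2))] at h5
    rw [h4, h5] at h3
    rw [h1]
    exact ((mul_eq_zero.1 h3.symm).resolve_left (pow_ne_zero _ h2))
  have hzero : hvL.toLp v = 0 := by
    apply UnitAddTorus.mFourierBasis.repr.injective
    ext m
    rw [UnitAddTorus.mFourierBasis_repr, hcoef m, map_zero]
    rfl
  have hv0 : v =ᵐ[volume] 0 := hvL.coeFn_toLp.symm.trans (hzero ▸ Lp.coeFn_zero ℂ 2 _)
  have hv1 : v =ᵐ[(cellMeasure n).map (toTorus n)] 0 := by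
    rw [map_toTorus]
    exact Measure.ae_smul_measure hv0 _
  have hv2 := ae_of_ae_map (measurable_toTorus n).aemeasurable hv1
  filter_upwards [hv2, hvw', huu'] with x hx1 hx2 hx3
  have hx4 : w x = 0 := hx2.symm.trans hx1
  rw [hx3]
  refine (mul_eq_zero.1 hx4).resolve_right ?_
  rw [map_eq_zero]
  exact norm_ne_zero_iff.1 (by rw [norm_planeWave]; norm_num)

end

section

/-! ### Convolution of sequences -/

/-- The convolution `(a ⋆ c)_m = ∑_q a_q c_{m-q}`. -/
def conv (a c : (Fin n → ℤ) → ℂ) (m : Fin n → ℤ) : ℂ := ∑' q, a q * c (m - q)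

theorem summable_norm_conv_term {a c : (Fin n → ℤ) → ℂ} (ha : Summable fun q => ‖a q‖) {C : ℝ}
    (hc : ∀ q, ‖c q‖ ≤ C) (m : Fin n → ℤ) : Summable fun q => ‖a q * c (m - q)‖ := by
  refine Summable.of_nonneg_of_le (fun _ => norm_nonneg _) (fun q => ?_) (ha.mul_right C)
  rw [norm_mul]
  exact mul_le_mul_of_nonneg_left (hc _) (norm_nonneg _)

theorem norm_conv_le {a c : (Fin n → ℤ) → ℂ} (ha : Summable fun q => ‖a q‖) {C : ℝ}
    (hc : ∀ q, ‖c q‖ ≤ C) (m : Fin n → ℤ) : ‖conv a c m‖ ≤ (∑' q, ‖a q‖) * C := by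
  refine (norm_tsum_le_tsum_norm (summable_norm_conv_term ha hc m)).trans ?_
  rw [← tsum_mul_right]
  refine (summable_norm_conv_term ha hc m).tsum_le_tsum (fun q => ?_) (ha.mul_right C)
  rw [norm_mul]
  exact mul_le_mul_of_nonneg_left (hc _) (norm_nonneg _)

theorem conv_sub_right {a c d : (Fin n → ℤ) → ℂ} (ha : Summable fun q => ‖a q‖) {C D : ℝ}
    (hc : ∀ q, ‖c q‖ ≤ C) (hd : ∀ q, ‖d q‖ ≤ D) (m : Fin n → ℤ) :
    conv a (c - d) m = conv a c m - conv a d m := by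
  rw [conv, conv, conv, ← (summable_norm_conv_term ha hc m).of_norm.tsum_sub
    (summable_norm_conv_term ha hd m).of_norm]
  exact tsum_congr fun q => by rw [Pi.sub_apply, mul_sub]

theorem conv_sub_left {a b c : (Fin n → ℤ) → ℂ} (ha : Summable fun q => ‖a q‖)
    (hb : Summable fun q => ‖b q‖) {C : ℝ} (hc : ∀ q, ‖c q‖ ≤ C) (m : Fin n → ℤ) :
    conv (a - b) c m = conv a c m - conv b c m := by
  rw [conv, conv, conv, ← (summable_norm_conv_term ha hc m).of_norm.tsum_sub
    (summable_norm_conv_term hb hc m).of_norm]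
  exact tsum_congr fun q => by rw [Pi.sub_apply, sub_mul]

theorem conv_smul_right (a c : (Fin n → ℤ) → ℂ) (z : ℂ) (m : Fin n → ℤ) :
    conv a (fun q => z * c q) m = z * conv a c m := by
  rw [conv, conv, ← tsum_mul_left]
  exact tsum_congr fun q => by ring

/-- Young's inequality `‖a ⋆ c‖₁ ≤ ‖a‖₁ ‖c‖₁`. -/
theorem tsum_enorm_conv_le (a c : (Fin n → ℤ) → ℂ) :
    ∑' m, ‖conv a c m‖ₑ ≤ (∑' q, ‖a q‖ₑ) * ∑' q, ‖c q‖ₑ := by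
  -- In `ℝ≥0∞` the sums may be interchanged without summability; where the series of `conv` diverges
  -- its value is 0, which is harmless in an upper bound.
  calc ∑' m, ‖conv a c m‖ₑ ≤ ∑' m, ∑' q, ‖a q‖ₑ * ‖c (m - q)‖ₑ := by
        refine ENNReal.tsum_le_tsum fun m => ?_
        refine (enorm_tsum_le_tsum_enorm).trans (ENNReal.tsum_le_tsum fun q => ?_)
        rw [enorm_mul]
    _ = ∑' q, ∑' m, ‖a q‖ₑ * ‖c (m - q)‖ₑ := ENNReal.tsum_comm
    _ = ∑' q, ‖a q‖ₑ * ∑' m, ‖c m‖ₑ := by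
        refine tsum_congr fun q => ?_
        rw [ENNReal.tsum_mul_left]
        congr 1
        exact (Equiv.subRight q).tsum_eq fun m => ‖c m‖ₑ
    _ = _ := ENNReal.tsum_mul_right

theorem summable_norm_iff_tsum_enorm {ι : Type*} {a : ι → ℂ} :
    (Summable fun q => ‖a q‖) ↔ ∑' q, ‖a q‖ₑ ≠ ∞ := by
  simp only [enorm_eq_nnnorm, ENNReal.tsum_coe_ne_top_iff_summable]
  exact NNReal.summable_coe (f := fun q => ‖a q‖₊)

theorem tsum_enorm_eq_ofReal {ι : Type*} {a : ι → ℂ} (ha : Summable fun q => ‖a q‖) :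
    ∑' q, ‖a q‖ₑ = ENNReal.ofReal (∑' q, ‖a q‖) := by
  rw [ENNReal.ofReal_tsum_of_nonneg (fun _ => norm_nonneg _) ha]
  exact tsum_congr fun q => (ofReal_norm _).symm

theorem summable_norm_conv {a c : (Fin n → ℤ) → ℂ} (ha : Summable fun q => ‖a q‖)
    (hc : Summable fun q => ‖c q‖) : Summable fun m => ‖conv a c m‖ := by
  rw [summable_norm_iff_tsum_enorm] at *
  exact ((tsum_enorm_conv_le a c).trans_lt (ENNReal.mul_lt_top ha.lt_top hc.lt_top)).ne

theorem tsum_norm_conv_le {a c : (Fin n → ℤ) → ℂ} (ha : Summable fun q => ‖a q‖)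
    (hc : Summable fun q => ‖c q‖) :
    ∑' m, ‖conv a c m‖ ≤ (∑' q, ‖a q‖) * ∑' q, ‖c q‖ := by
  have h0 : ∀ b : (Fin n → ℤ) → ℂ, 0 ≤ ∑' q, ‖b q‖ := fun b => tsum_nonneg fun _ => norm_nonneg _
  have h := tsum_enorm_conv_le a c
  rw [tsum_enorm_eq_ofReal ha, tsum_enorm_eq_ofReal hc,
    tsum_enorm_eq_ofReal (summable_norm_conv ha hc), ← ENNReal.ofReal_mul (h0 a)] at h
  exact (ENNReal.ofReal_le_ofReal_iff (mul_nonneg (h0 a) (h0 c))).1 h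

/-- Convolution with a Hermitian sequence is a symmetric operator. -/
theorem tsum_conv_mul_conj {a f g : (Fin n → ℤ) → ℂ} (ha : Summable fun q => ‖a q‖)
    (hherm : ∀ q, a (-q) = starRingEnd ℂ (a q)) (hf : Summable fun q => ‖f q‖) {C : ℝ}
    (hg : ∀ q, ‖g q‖ ≤ C) :
    ∑' m, conv a f m * starRingEnd ℂ (g m) = ∑' m, f m * starRingEnd ℂ (conv a g m) := by
  set F : (Fin n → ℤ) × (Fin n → ℤ) → ℂ :=
    fun p => a p.1 * f p.2 * starRingEnd ℂ (g (p.2 + p.1)) with hF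
  have hFs : Summable F := by
    have h1 : Summable fun p : (Fin n → ℤ) × (Fin n → ℤ) => ‖a p.1‖ * ‖f p.2‖ :=
      ha.mul_of_nonneg hf (fun _ => norm_nonneg _) fun _ => norm_nonneg _
    refine Summable.of_norm_bounded (h1.mul_right C) fun p => ?_
    rw [hF, norm_mul, norm_mul, RCLike.norm_conj]
    exact mul_le_mul_of_nonneg_left (hg _) (by positivity)
  -- The shear `(q, m) ↦ (q, m - q)` turns the double series of the right side into that of the left
  -- side.
  set e : (Fin n → ℤ) × (Fin n → ℤ) ≃ (Fin n → ℤ) × (Fin n → ℤ) :=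
    Equiv.prodShear (Equiv.refl _) fun q => Equiv.subRight q with he
  have hGs : Summable (F ∘ e) := (e.summable_iff).2 hFs
  have h1 : ∀ m, conv a f m * starRingEnd ℂ (g m) = ∑' q, (F ∘ e) (q, m) := by
    intro m
    rw [conv, ← tsum_mul_right]
    refine tsum_congr fun q => ?_
    simp [hF, he]
  have h2 : ∀ m, f m * starRingEnd ℂ (conv a g m) = ∑' q, F (q, m) := by
    intro m
    -- After `q ↦ -q` the Hermitian condition replaces `conj (a (-q))` by `a q`.
    rw [conv, Complex.conj_tsum, ← tsum_mul_left, ← (Equiv.neg _).tsum_eq]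
    refine tsum_congr fun q => ?_
    simp only [hF, Equiv.neg_apply, map_mul, hherm, Complex.conj_conj, sub_neg_eq_add]
    ring
  simp only [h1, h2]
  have h3 : ∑' m, ∑' q, F (q, m) = ∑' p, F p := by
    rw [← (Equiv.prodComm _ _).tsum_eq]
    exact (((Equiv.prodComm _ _).summable_iff.2 hFs).tsum_prod).symm
  have h4 : ∑' m, ∑' q, (F ∘ e) (q, m) = ∑' p, (F ∘ e) p := by
    rw [← (Equiv.prodComm _ _).tsum_eq]
    exact (((Equiv.prodComm _ _).summable_iff.2 hGs).tsum_prod).symm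
  rw [h3, h4]
  exact e.tsum_eq F

/-! ### Sums of plane waves -/

/-- The function `∑_m a_m ψ_m`. -/
def waveSum (t : Space n) (a : (Fin n → ℤ) → ℂ) (x : Space n) : ℂ :=
  ∑' m, a m * planeWave t m x

variable {a b : (Fin n → ℤ) → ℂ}

theorem summable_norm_waveSum_term (ha : Summable fun q => ‖a q‖) (t x : Space n) :
    Summable fun m => ‖a m * planeWave t m x‖ := by
  simpa [norm_planeWave] using ha

theorem continuous_waveSum (ha : Summable fun q => ‖a q‖) (t : Space n) :
    Continuous (waveSum t a) :=
  continuous_tsum (fun m => continuous_const.mul (continuous_planeWave t m)) ha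
    fun m x => by rw [norm_mul, norm_planeWave, mul_one]

theorem norm_waveSum_le (ha : Summable fun q => ‖a q‖) (t x : Space n) :
    ‖waveSum t a x‖ ≤ ∑' q, ‖a q‖ := by
  refine (norm_tsum_le_tsum_norm (summable_norm_waveSum_term ha t x)).trans_eq ?_
  exact tsum_congr fun q => by rw [norm_mul, norm_planeWave, mul_one]

theorem memLp_waveSum (ha : Summable fun q => ‖a q‖) (t : Space n) (p : ℝ≥0∞) :
    MemLp (waveSum t a) p (cellMeasure n) :=
  MemLp.of_bound (continuous_waveSum ha t).aestronglyMeasurable _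
    (Filter.Eventually.of_forall fun x => norm_waveSum_le ha t x)

theorem conj_waveSum (t : Space n) (a : (Fin n → ℤ) → ℂ) (x : Space n) :
    starRingEnd ℂ (waveSum t a x) = waveSum (-t) (fun m => starRingEnd ℂ (a (-m))) x := by
  rw [waveSum, waveSum, Complex.conj_tsum, ← (Equiv.neg _).tsum_eq]
  refine tsum_congr fun q => ?_
  simp only [Equiv.neg_apply, map_mul, conj_planeWave, neg_neg]

/-! ### Coefficients along the plane waves -/

theorem integrable_mul_conj_planeWave' {u : Space n → ℂ} (hu : Integrable u (cellMeasure n))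
    (t : Space n) (m : Fin n → ℤ) :
    Integrable (fun x => u x * starRingEnd ℂ (planeWave t m x)) (cellMeasure n) := by
  refine hu.mul_bdd (c := 1)
    (Complex.continuous_conj.comp (continuous_planeWave t m)).aestronglyMeasurable
    (Filter.Eventually.of_forall fun x => ?_)
  simp [norm_planeWave]

theorem blochCoeff_congr {u v : Space n → ℂ} (h : u =ᵐ[cellMeasure n] v) (t : Space n)
    (m : Fin n → ℤ) : blochCoeff t u m = blochCoeff t v m := by
  rw [blochCoeff, blochCoeff, integral_congr_ae]
  filter_upwards [h] with x hx
  rw [hx]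

theorem blochCoeff_sub {u v : Space n → ℂ} (hu : Integrable u (cellMeasure n))
    (hv : Integrable v (cellMeasure n)) (t : Space n) (m : Fin n → ℤ) :
    blochCoeff t (fun x => u x - v x) m = blochCoeff t u m - blochCoeff t v m := by
  rw [blochCoeff, blochCoeff, blochCoeff, ← mul_sub, ← integral_sub
    (integrable_mul_conj_planeWave' hu t m) (integrable_mul_conj_planeWave' hv t m)]
  simp only [sub_mul]

theorem blochCoeff_const_mul (c : ℂ) (u : Space n → ℂ) (t : Space n) (m : Fin n → ℤ) :
    blochCoeff t (fun x => c * u x) m = c * blochCoeff t u m := by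
  simp only [blochCoeff, mul_assoc]
  rw [integral_const_mul]
  ring

theorem norm_blochCoeff_le (u : Space n → ℂ) (t : Space n) (m : Fin n → ℤ) :
    ‖blochCoeff t u m‖ ≤ ((2 * Real.pi)⁻¹) ^ n * ∫ x in cell n, ‖u x‖ := by
  rw [blochCoeff, norm_mul]
  refine mul_le_mul (le_of_eq ?_) ?_ (norm_nonneg _) (by positivity)
  · rw [norm_pow, norm_inv, Complex.norm_real, Real.norm_of_nonneg (by positivity)]
  · refine (norm_integral_le_integral_norm _).trans_eq ?_
    simp [norm_planeWave]

/-- Plane waves multiply by adding indices and quasimomenta, and absolute summability permits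
termwise integration. The case `s = 0` describes a potential acting on `u`, the case `s = -t` the
density `|u|²`. -/
theorem blochCoeff_waveSum_mul (ha : Summable fun q => ‖a q‖) {u : Space n → ℂ}
    (hu : Integrable u (cellMeasure n)) (s t : Space n) (m : Fin n → ℤ) :
    blochCoeff (s + t) (fun x => waveSum s a x * u x) m = conv a (blochCoeff t u) m := by
  have hmul : ∀ q x, planeWave s q x * starRingEnd ℂ (planeWave (s + t) m x) =
      starRingEnd ℂ (planeWave t (m - q) x) := by
    intro q x
    rw [conj_planeWave, conj_planeWave, planeWave_add]
    congr 1 <;> abel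
  have hI : ∀ q, Integrable (fun x => a q * (u x * starRingEnd ℂ (planeWave t (m - q) x)))
      (cellMeasure n) := fun q => (integrable_mul_conj_planeWave' hu t (m - q)).const_mul _
  have hS : Summable fun q => ∫ x in cell n,
      ‖a q * (u x * starRingEnd ℂ (planeWave t (m - q) x))‖ := by
    simpa [norm_planeWave, integral_const_mul] using ha.mul_right (∫ x in cell n, ‖u x‖)
  have h := (hasSum_integral_of_summable_integral_norm hI hS).tsum_eq
  have hx : ∀ x, waveSum s a x * u x * starRingEnd ℂ (planeWave (s + t) m x) =
      ∑' q, a q * (u x * starRingEnd ℂ (planeWave t (m - q) x)) := by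
    intro x
    rw [waveSum, ← tsum_mul_right, ← tsum_mul_right]
    refine tsum_congr fun q => ?_
    rw [← hmul]
    ring
  rw [blochCoeff]
  simp only [hx]
  rw [← h, conv, ← tsum_mul_left]
  refine tsum_congr fun q => ?_
  rw [integral_const_mul, blochCoeff]
  ring

theorem blochCoeff_waveSum (ha : Summable fun q => ‖a q‖) (t : Space n) (m : Fin n → ℤ) :
    blochCoeff t (waveSum t a) m = a m := by
  have h := blochCoeff_waveSum_mul ha (memLp_planeWave 0 0 |>.integrable one_le_two) t 0 m
  simp only [planeWave_zero_zero, mul_one, add_zero] at h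
  rw [show blochCoeff t (waveSum t a) m = blochCoeff t (fun x => waveSum t a x) m from rfl, h,
    conv, tsum_eq_single m]
  · simp [blochCoeff_planeWave]
  · intro q hq
    simp [blochCoeff_planeWave, sub_eq_zero, hq.symm]

theorem eq_waveSum_of_summable_blochCoeff {u : Space n → ℂ} (hu : MemLp u 2 (cellMeasure n))
    (t : Space n) (hs : Summable fun m => ‖blochCoeff t u m‖) :
    u =ᵐ[cellMeasure n] waveSum t (blochCoeff t u) := by
  have h := ae_eq_zero_of_blochCoeff_eq_zero (hu.sub (memLp_waveSum hs t 2)) t fun m => by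
    have := blochCoeff_sub (hu.integrable one_le_two)
      ((memLp_waveSum hs t 2).integrable one_le_two) t m
    rw [blochCoeff_waveSum hs, sub_self] at this
    exact this
  filter_upwards [h] with x hx
  exact sub_eq_zero.1 hx

theorem fourierCoef_neg (W : Space n → ℝ) (q : Fin n → ℤ) :
    fourierCoef W (-q) = starRingEnd ℂ (fourierCoef W q) := by
  rw [fourierCoef, fourierCoef, blochCoeff, blochCoeff, map_mul, ← integral_conj]
  congr 1
  · rw [map_pow, map_inv₀, Complex.conj_ofReal]
  · congr 1
    funext x
    rw [map_mul, Complex.conj_ofReal, conj_planeWave, conj_planeWave, conj_planeWave]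
    simp

end

section

/-! ### The space `ℓ¹` of sequences -/

/-- The Banach space `ℓ¹(ℤⁿ)`. -/
abbrev SeqL1 (n : ℕ) : Type := lp (fun _ : Fin n → ℤ => ℂ) 1

theorem SeqL1.summable_norm (f : SeqL1 n) : Summable fun m => ‖f m‖ := by
  simpa using (lp.memℓp f).summable (by simp)

theorem SeqL1.norm_eq (f : SeqL1 n) : ‖f‖ = ∑' m, ‖f m‖ := by
  rw [lp.norm_eq_tsum_rpow (by simp)]
  simp

theorem SeqL1.norm_apply_le (f : SeqL1 n) (m : Fin n → ℤ) : ‖f m‖ ≤ ‖f‖ :=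
  lp.norm_apply_le_norm one_ne_zero f m

/-- A summable sequence as an element of `ℓ¹`. -/
def SeqL1.mk (f : (Fin n → ℤ) → ℂ) (hf : Summable fun m => ‖f m‖) : SeqL1 n :=
  ⟨f, memℓp_gen (by simpa using hf)⟩

@[simp]
theorem SeqL1.coe_mk (f : (Fin n → ℤ) → ℂ) (hf : Summable fun m => ‖f m‖) :
    (SeqL1.mk f hf : (Fin n → ℤ) → ℂ) = f := rfl

theorem SeqL1.norm_le_of_forall_le {x y z : SeqL1 n} {α β : ℝ}
    (h : ∀ m, ‖x m‖ ≤ α * ‖y m‖ + β * ‖z m‖) : ‖x‖ ≤ α * ‖y‖ + β * ‖z‖ := by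
  rw [x.norm_eq, y.norm_eq, z.norm_eq, ← tsum_mul_left, ← tsum_mul_left,
    ← (y.summable_norm.mul_left α).tsum_add (z.summable_norm.mul_left β)]
  exact x.summable_norm.tsum_le_tsum h
    ((y.summable_norm.mul_left α).add (z.summable_norm.mul_left β))

/-- The basis sequence concentrated at `j`. -/
def SeqL1.basis (j : Fin n → ℤ) : SeqL1 n := lp.single 1 j (1 : ℂ)

theorem SeqL1.basis_apply (j m : Fin n → ℤ) : SeqL1.basis j m = if m = j then 1 else 0 := by
  rw [SeqL1.basis, lp.coeFn_single, Pi.single_apply]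

theorem SeqL1.norm_basis (j : Fin n → ℤ) : ‖SeqL1.basis j‖ = 1 := by
  rw [SeqL1.basis, lp.norm_single (by simp), norm_one]

/-- The convolution on `ℓ¹`. -/
def SeqL1.conv (a c : SeqL1 n) : SeqL1 n :=
  SeqL1.mk (Polyharmonic.conv a c) (summable_norm_conv a.summable_norm c.summable_norm)

theorem SeqL1.norm_conv_le (a c : SeqL1 n) : ‖SeqL1.conv a c‖ ≤ ‖a‖ * ‖c‖ := by
  rw [SeqL1.norm_eq, a.norm_eq, c.norm_eq]
  exact tsum_norm_conv_le a.summable_norm c.summable_norm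

theorem SeqL1.conv_sub_conv (a b c d : SeqL1 n) :
    SeqL1.conv a c - SeqL1.conv b d = SeqL1.conv (a - b) c + SeqL1.conv b (c - d) := by
  ext m
  simp only [lp.coeFn_sub, lp.coeFn_add, Pi.sub_apply, Pi.add_apply, SeqL1.conv, SeqL1.coe_mk]
  rw [conv_sub_left a.summable_norm b.summable_norm c.norm_apply_le,
    conv_sub_right b.summable_norm c.norm_apply_le d.norm_apply_le]
  ring

theorem SeqL1.norm_conv_sub_conv_le (a b c d : SeqL1 n) :
    ‖SeqL1.conv a c - SeqL1.conv b d‖ ≤ ‖a - b‖ * ‖c‖ + ‖b‖ * ‖c - d‖ := by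
  rw [SeqL1.conv_sub_conv]
  exact (norm_add_le _ _).trans (add_le_add (SeqL1.norm_conv_le _ _) (SeqL1.norm_conv_le _ _))

theorem SeqL1.zero_conv (c : SeqL1 n) : SeqL1.conv 0 c = 0 := by
  rw [← norm_le_zero_iff]
  simpa using SeqL1.norm_conv_le 0 c

/-! ### Perturbation of a simple eigenvalue in `ℓ¹` -/

/-- The levels `D` have exactly one level, `D j`, near `E`, and a gap of order `b` around it. -/
structure IsIsolatedLevel (D : (Fin n → ℤ) → ℝ) (E b : ℝ) (j : Fin n → ℤ) : Prop where
  pos : 0 < b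
  near : |D j - E| ≤ b / 4
  far : ∀ m, m ≠ j → 7 / 4 * b ≤ |D m - E|

variable {D : (Fin n → ℤ) → ℝ} {E b : ℝ} {j : Fin n → ℤ}

/-- The energy `D_j + Re (w ⋆ f)_j`. -/
def level (D : (Fin n → ℤ) → ℝ) (j : Fin n → ℤ) (w f : SeqL1 n) : ℝ :=
  -- The real part keeps the denominators of `stateSeq` real for every `f`; at the fixed point the
  -- imaginary part vanishes by `IsState.eigen`.
  D j + (SeqL1.conv w f j).re

/-- The sequence `f'` with `f'_j = 1` and `(λ - D_m) f'_m = (w ⋆ f)_m` for `m ≠ j`, where `λ` is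
the energy `D_j + Re (w ⋆ f)_j`. -/
def stateSeq (D : (Fin n → ℤ) → ℝ) (j : Fin n → ℤ) (w f : SeqL1 n) (m : Fin n → ℤ) : ℂ :=
  if m = j then 1 else SeqL1.conv w f m / ((level D j w f - D m : ℝ) : ℂ)

open Classical in
/-- The map `f ↦ f'` of `stateSeq` on `ℓ¹`. -/
def stateMap (D : (Fin n → ℤ) → ℝ) (j : Fin n → ℤ) (w f : SeqL1 n) : SeqL1 n :=
  -- The value 0 does not occur for small `w` and `‖f‖ ≤ 2`, by `coe_stateMap`.
  if h : Summable fun m => ‖stateSeq D j w f m‖ then SeqL1.mk (stateSeq D j w f) h else 0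

/-- To the initial distance `b/4` the potential adds at most `2‖w‖ ≤ b/32`. -/
theorem abs_level_sub_le (h : IsIsolatedLevel D E b j) {w f : SeqL1 n} (hw : 64 * ‖w‖ ≤ b)
    (hf : ‖f‖ ≤ 2) : |level D j w f - E| ≤ b / 2 := by
  have h1 : |(SeqL1.conv w f j).re| ≤ ‖w‖ * 2 :=
    ((Complex.abs_re_le_norm _).trans (SeqL1.norm_apply_le _ j)).trans
      ((SeqL1.norm_conv_le w f).trans (mul_le_mul_of_nonneg_left hf (norm_nonneg _)))
  have h2 := h.near
  have h3 := h.pos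
  rw [abs_le] at *
  unfold level
  constructor <;> linarith

theorem IsIsolatedLevel.le_abs_sub (h : IsIsolatedLevel D E b j) {μ c : ℝ} (hμ : |μ - E| ≤ c)
    {m : Fin n → ℤ} (hm : m ≠ j) : 7 / 4 * b - c ≤ |μ - D m| := by
  have h1 := h.far m hm
  have h2 := abs_sub_le (D m) μ E
  rw [abs_sub_comm (D m) μ] at h2
  linarith

theorem le_abs_level_sub (h : IsIsolatedLevel D E b j) {w f : SeqL1 n} (hw : 64 * ‖w‖ ≤ b)
    (hf : ‖f‖ ≤ 2) {m : Fin n → ℤ} (hm : m ≠ j) : b ≤ |level D j w f - D m| := by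
  have h1 := h.le_abs_sub (abs_level_sub_le h hw hf) hm
  have h2 := h.pos
  linarith

theorem norm_stateSeq_le (h : IsIsolatedLevel D E b j) {w f : SeqL1 n} (hw : 64 * ‖w‖ ≤ b)
    (hf : ‖f‖ ≤ 2) (m : Fin n → ℤ) :
    ‖stateSeq D j w f m‖ ≤ 1 * ‖SeqL1.basis j m‖ + b⁻¹ * ‖SeqL1.conv w f m‖ := by
  have hb := h.pos
  rw [stateSeq, SeqL1.basis_apply]
  split_ifs with hm
  · simp only [norm_one, mul_one]
    have : 0 ≤ b⁻¹ * ‖SeqL1.conv w f m‖ := by positivity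
    linarith
  · rw [norm_zero, mul_zero, zero_add, norm_div, Complex.norm_real, Real.norm_eq_abs, div_eq_inv_mul]
    gcongr
    exact le_abs_level_sub h hw hf hm

theorem coe_stateMap (h : IsIsolatedLevel D E b j) {w f : SeqL1 n} (hw : 64 * ‖w‖ ≤ b)
    (hf : ‖f‖ ≤ 2) : (stateMap D j w f : (Fin n → ℤ) → ℂ) = stateSeq D j w f := by
  have hs : Summable fun m => ‖stateSeq D j w f m‖ :=
    Summable.of_nonneg_of_le (fun _ => norm_nonneg _) (norm_stateSeq_le h hw hf)
      (((SeqL1.basis j).summable_norm.mul_left 1).add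
        ((SeqL1.conv w f).summable_norm.mul_left b⁻¹))
  rw [stateMap, dif_pos hs, SeqL1.coe_mk]

/-- The entry at `j` contributes 1, and the others at most `‖w ⋆ f‖/b ≤ 1`. -/
theorem norm_stateMap_le (h : IsIsolatedLevel D E b j) {w f : SeqL1 n} (hw : 64 * ‖w‖ ≤ b)
    (hf : ‖f‖ ≤ 2) : ‖stateMap D j w f‖ ≤ 2 := by
  have hb := h.pos
  have h1 : ‖stateMap D j w f‖ ≤ 1 * ‖SeqL1.basis j‖ + b⁻¹ * ‖SeqL1.conv w f‖ := by
    refine SeqL1.norm_le_of_forall_le fun m => ?_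
    rw [coe_stateMap h hw hf]
    exact norm_stateSeq_le h hw hf m
  have h2 : ‖SeqL1.conv w f‖ ≤ b := by
    refine (SeqL1.norm_conv_le w f).trans ?_
    nlinarith [norm_nonneg w, norm_nonneg f]
  have h3 : b⁻¹ * ‖SeqL1.conv w f‖ ≤ 1 := by
    rw [inv_mul_le_iff₀ hb, mul_one]
    exact h2
  rw [SeqL1.norm_basis] at h1
  linarith

/-- The map `stateMap` is a contraction in `f` and Lipschitz continuous in the potential. -/
theorem norm_stateMap_sub_le (h : IsIsolatedLevel D E b j) {w w' f f' : SeqL1 n}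
    (hw : 64 * ‖w‖ ≤ b) (hw' : 64 * ‖w'‖ ≤ b) (hf : ‖f‖ ≤ 2) (hf' : ‖f'‖ ≤ 2) :
    ‖stateMap D j w f - stateMap D j w' f'‖ ≤ 1 / 2 * ‖f - f'‖ + 4 / b * ‖w - w'‖ := by
  have hb := h.pos
  set Δ := ‖SeqL1.conv w f - SeqL1.conv w' f'‖ with hΔ
  have hlev : |level D j w f - level D j w' f'| ≤ Δ := by
    have : level D j w f - level D j w' f' = ((SeqL1.conv w f - SeqL1.conv w' f') j).re := by
      simp [level]
    rw [this]
    exact (Complex.abs_re_le_norm _).trans (SeqL1.norm_apply_le _ j)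
  have h1 : ‖stateMap D j w f - stateMap D j w' f'‖ ≤
      b⁻¹ * ‖SeqL1.conv w f - SeqL1.conv w' f'‖ + Δ / b ^ 2 * ‖SeqL1.conv w' f'‖ := by
    refine SeqL1.norm_le_of_forall_le fun m => ?_
    rw [lp.coeFn_sub, lp.coeFn_sub, Pi.sub_apply, Pi.sub_apply, coe_stateMap h hw hf,
      coe_stateMap h hw' hf', stateSeq, stateSeq]
    split_ifs with hm
    · rw [sub_self, norm_zero]
      positivity
    · set A := SeqL1.conv w f m
      set A' := SeqL1.conv w' f' m
      have hx := le_abs_level_sub h hw hf hm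
      have hy := le_abs_level_sub h hw' hf' hm
      set x := level D j w f - D m with hxdef
      set y := level D j w' f' - D m with hydef
      have hx0 : (x : ℂ) ≠ 0 := by
        rw [Complex.ofReal_ne_zero, ← abs_pos]; linarith
      have hy0 : (y : ℂ) ≠ 0 := by
        rw [Complex.ofReal_ne_zero, ← abs_pos]; linarith
      -- The numerator changes and the energy in the denominator shifts; the shift does not depend
      -- on `m` and is at most `Δ`.
      have he : A / x - A' / y = (A - A') / x + A' * ((y - x : ℝ) : ℂ) / (x * y) := by
        push_cast
        field_simp
        ring
      rw [he]
      refine (norm_add_le _ _).trans (add_le_add ?_ ?_)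
      · rw [norm_div, Complex.norm_real, Real.norm_eq_abs, div_eq_inv_mul]
        gcongr
      · rw [norm_div, norm_mul, norm_mul, Complex.norm_real, Complex.norm_real, Complex.norm_real,
          Real.norm_eq_abs, Real.norm_eq_abs, Real.norm_eq_abs, mul_comm ‖A'‖, ← div_mul_eq_mul_div]
        have hyx : |y - x| ≤ Δ := by
          rw [abs_sub_comm, hxdef, hydef, sub_sub_sub_cancel_right]
          exact hlev
        have hxy : b ^ 2 ≤ |x| * |y| := by
          rw [pow_two]; exact mul_le_mul hx hy hb.le (abs_nonneg _)
        gcongr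
  -- Hence both error terms are at most `Δ/b`, and the bound `h3` on `Δ` yields the constants `2/64
  -- ≤ 1/2` and `4/b`.
  have h2 : ‖SeqL1.conv w' f'‖ ≤ b :=
    (SeqL1.norm_conv_le w' f').trans (by nlinarith [norm_nonneg w', norm_nonneg f'])
  have h3 : Δ ≤ ‖w - w'‖ * 2 + ‖w'‖ * ‖f - f'‖ :=
    (SeqL1.norm_conv_sub_conv_le w w' f f').trans (by gcongr)
  have h4 : Δ / b ^ 2 * ‖SeqL1.conv w' f'‖ ≤ b⁻¹ * Δ := by
    calc Δ / b ^ 2 * ‖SeqL1.conv w' f'‖ ≤ Δ / b ^ 2 * b := by gcongr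
      _ = b⁻¹ * Δ := by field_simp
  have h5 : b⁻¹ * (‖w'‖ * ‖f - f'‖) ≤ 1 / 64 * ‖f - f'‖ := by
    have : b⁻¹ * ‖w'‖ ≤ 1 / 64 := by
      rw [inv_mul_le_iff₀ hb]; linarith
    rw [← mul_assoc]
    gcongr
  have h6 : b⁻¹ * Δ ≤ b⁻¹ * (‖w - w'‖ * 2 + ‖w'‖ * ‖f - f'‖) := by gcongr
  have h7 : 4 / b * ‖w - w'‖ = 2 * (b⁻¹ * (‖w - w'‖ * 2)) := by ring
  rw [mul_add] at h6
  have h8 := norm_nonneg (f - f')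
  linarith

/-- `f` is the normalized eigenvector of the perturbed problem. -/
structure IsState (D : (Fin n → ℤ) → ℝ) (j : Fin n → ℤ) (w f : SeqL1 n) : Prop where
  norm_le : ‖f‖ ≤ 2
  fixed : stateMap D j w f = f

/-- Banach's fixed point theorem on the closed ball of radius 2. -/
theorem exists_isState (h : IsIsolatedLevel D E b j) {w : SeqL1 n} (hw : 64 * ‖w‖ ≤ b) :
    ∃ f, IsState D j w f := by
  have hmaps : MapsTo (stateMap D j w) (Metric.closedBall 0 2) (Metric.closedBall 0 2) := by
    intro f hf
    rw [mem_closedBall_zero_iff] at *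
    exact norm_stateMap_le h hw hf
  have hlip : LipschitzOnWith (1 / 2) (stateMap D j w) (Metric.closedBall 0 2) := by
    refine LipschitzOnWith.of_dist_le_mul fun f hf g hg => ?_
    rw [mem_closedBall_zero_iff] at *
    have := norm_stateMap_sub_le h hw hw hf hg
    rw [sub_self, norm_zero, mul_zero, add_zero] at this
    simpa [dist_eq_norm] using this
  obtain ⟨f, hf, hfix, -⟩ := ContractingWith.exists_fixedPoint'
    (Metric.isClosed_closedBall (x := (0 : SeqL1 n)) (ε := 2)).isComplete hmaps
    ⟨by norm_num, hlip.mapsToRestrict hmaps⟩ (x := 0) (by simp) (edist_ne_top _ _)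
  exact ⟨f, mem_closedBall_zero_iff.1 hf, hfix⟩

theorem isState_basis (h : IsIsolatedLevel D E b j) : IsState D j 0 (SeqL1.basis j) := by
  have hn : ‖SeqL1.basis j‖ ≤ 2 := by rw [SeqL1.norm_basis]; norm_num
  refine ⟨hn, ?_⟩
  ext m
  rw [coe_stateMap h (by simpa using h.pos.le) hn, stateSeq, SeqL1.zero_conv, SeqL1.basis_apply]
  simp

/-- The term `‖f - f'‖/2` of the contraction estimate is absorbed on the left, which doubles `4/b`.
For `w = w'` this gives uniqueness of the state. -/
theorem IsState.norm_sub_le (h : IsIsolatedLevel D E b j) {w w' f f' : SeqL1 n}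
    (hw : 64 * ‖w‖ ≤ b) (hw' : 64 * ‖w'‖ ≤ b) (hf : IsState D j w f) (hf' : IsState D j w' f') :
    ‖f - f'‖ ≤ 8 / b * ‖w - w'‖ := by
  have h1 := norm_stateMap_sub_le h hw hw' hf.norm_le hf'.norm_le
  rw [hf.fixed, hf'.fixed] at h1
  have : 8 / b * ‖w - w'‖ = 2 * (4 / b * ‖w - w'‖) := by ring
  linarith

theorem IsState.apply_eq (h : IsIsolatedLevel D E b j) {w f : SeqL1 n} (hw : 64 * ‖w‖ ≤ b)
    (hf : IsState D j w f) (m : Fin n → ℤ) : f m = stateSeq D j w f m := by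
  rw [← coe_stateMap h hw hf.norm_le, hf.fixed]

theorem IsState.apply_self (h : IsIsolatedLevel D E b j) {w f : SeqL1 n} (hw : 64 * ‖w‖ ≤ b)
    (hf : IsState D j w f) : f j = 1 := by
  rw [hf.apply_eq h hw, stateSeq, if_pos rfl]

theorem IsState.mul_apply_of_ne (h : IsIsolatedLevel D E b j) {w f : SeqL1 n}
    (hw : 64 * ‖w‖ ≤ b) (hf : IsState D j w f) {m : Fin n → ℤ} (hm : m ≠ j) :
    ((level D j w f - D m : ℝ) : ℂ) * f m = conv w f m := by
  have h1 := le_abs_level_sub h hw hf.norm_le hm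
  have h2 : ((level D j w f - D m : ℝ) : ℂ) ≠ 0 := by
    rw [Complex.ofReal_ne_zero, ← abs_pos]
    exact h.pos.trans_le h1
  rw [hf.apply_eq h hw m, stateSeq, if_neg hm, mul_div_cancel₀ _ h2]
  rfl

/-- A sequence is Hermitian if it is the Fourier transform of a real function. -/
def IsHermitianSeq (w : (Fin n → ℤ) → ℂ) : Prop := ∀ q, w (-q) = starRingEnd ℂ (w q)

theorem summable_mul_conj {f g : (Fin n → ℤ) → ℂ} (hf : Summable fun m => ‖f m‖) {C : ℝ}
    (hg : ∀ m, ‖g m‖ ≤ C) : Summable fun m => ‖f m * starRingEnd ℂ (g m)‖ := by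
  refine Summable.of_nonneg_of_le (fun _ => norm_nonneg _) (fun m => ?_) (hf.mul_right C)
  rw [norm_mul, RCLike.norm_conj]
  exact mul_le_mul_of_nonneg_left (hg m) (norm_nonneg _)

/-- The eigenvalue equation of a state. -/
theorem IsState.eigen (h : IsIsolatedLevel D E b j) {w f : SeqL1 n} (hw : 64 * ‖w‖ ≤ b)
    (hherm : IsHermitianSeq w) (hf : IsState D j w f) (m : Fin n → ℤ) :
    ((level D j w f - D m : ℝ) : ℂ) * f m = conv w f m := by
  rcases ne_or_eq m j with hm | rfl
  · exact hf.mul_apply_of_ne h hw hm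
  have hfm := hf.apply_self h hw
  have hsym := tsum_conv_mul_conj w.summable_norm hherm f.summable_norm f.norm_apply_le
  have hcs := (SeqL1.conv w f).summable_norm
  have hs1 := (summable_mul_conj hcs f.norm_apply_le).of_norm
  have hs2 := (summable_mul_conj f.summable_norm (SeqL1.conv w f).norm_apply_le).of_norm
  rw [← sub_eq_zero] at hsym
  have h1 : ∑' q, (conv w f q * starRingEnd ℂ (f q) - f q * starRingEnd ℂ (conv w f q)) = 0 :=
    (hs1.tsum_sub hs2).trans hsym
  -- Away from the isolated index the eigenvalue equation has a real factor, so these terms cancel.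
  -- The one remaining term says that `(w ⋆ f)_j` equals its conjugate.
  rw [tsum_eq_single m] at h1
  · have h2 : level D m w f - D m = (conv w f m).re := by
      simp [level, SeqL1.conv]
    rw [hfm, map_one, mul_one, one_mul, sub_eq_zero] at h1
    rw [hfm, mul_one, h2]
    exact Complex.conj_eq_iff_re.1 h1.symm
  · intro q hq
    rw [← hf.mul_apply_of_ne h hw hq, map_mul, Complex.conj_ofReal]
    ring

/-- The gap gives `|μ - D_m| ≥ 3b/4`, whereas `|(w ⋆ g)_m| ≤ bC/64`. -/
theorem norm_le_half_of_eigen (h : IsIsolatedLevel D E b j) {w : SeqL1 n} (hw : 64 * ‖w‖ ≤ b)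
    {μ : ℝ} (hμ : |μ - E| ≤ b) {g : (Fin n → ℤ) → ℂ} {C : ℝ} (hC : 0 ≤ C) (hg : ∀ m, ‖g m‖ ≤ C)
    {m : Fin n → ℤ} (hm : m ≠ j) (he : ((μ - D m : ℝ) : ℂ) * g m = conv w g m) :
    ‖g m‖ ≤ C / 2 := by
  have hb := h.pos
  have h1 := h.le_abs_sub hμ hm
  have h2 := norm_conv_le w.summable_norm hg m
  rw [← he, norm_mul, Complex.norm_real, Real.norm_eq_abs, ← w.norm_eq] at h2
  have h3 : 3 / 4 * b * ‖g m‖ ≤ b / 64 * C := by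
    calc 3 / 4 * b * ‖g m‖ ≤ |μ - D m| * ‖g m‖ := by gcongr; linarith
      _ ≤ ‖w‖ * C := h2
      _ ≤ b / 64 * C := by gcongr; linarith
  have h4 : b * (‖g m‖ - C / 2) ≤ 0 := by nlinarith
  have h5 := nonpos_of_mul_nonpos_right h4 hb
  linarith

/-- The supremum is itself a bound, so it is at most half of itself. Boundedness suffices, which
matters because the coefficients of an `L²` eigenfunction are not known to be summable. -/
theorem eq_zero_of_forall_norm_le_half {ι : Type*} {g : ι → ℂ} {C₀ : ℝ}
    (hg : ∀ m, ‖g m‖ ≤ C₀)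
    (h : ∀ C, 0 ≤ C → (∀ m, ‖g m‖ ≤ C) → ∀ m, ‖g m‖ ≤ C / 2) (m : ι) : g m = 0 := by
  have hbdd : BddAbove (range fun m => ‖g m‖) := ⟨C₀, by rintro _ ⟨m, rfl⟩; exact hg m⟩
  have hle : ∀ m, ‖g m‖ ≤ ⨆ m, ‖g m‖ := le_ciSup hbdd
  have hnn : 0 ≤ ⨆ m, ‖g m‖ := (norm_nonneg _).trans (hle m)
  have : Nonempty ι := ⟨m⟩
  have h1 : (⨆ m, ‖g m‖) ≤ (⨆ m, ‖g m‖) / 2 := ciSup_le (h _ hnn hle)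
  have h2 : ‖g m‖ ≤ 0 := (hle m).trans (by linarith)
  exact norm_le_zero_iff.1 h2

/-- Bounded eigenvectors with eigenvalue in the window are multiples of the state. -/
theorem IsState.eq_smul_of_eigen (h : IsIsolatedLevel D E b j) {w f : SeqL1 n}
    (hw : 64 * ‖w‖ ≤ b) (hherm : IsHermitianSeq w) (hf : IsState D j w f) {μ : ℝ}
    (hμ : |μ - E| ≤ b) {g : (Fin n → ℤ) → ℂ} {C : ℝ} (hg : ∀ m, ‖g m‖ ≤ C)
    (he : ∀ m, ((μ - D m : ℝ) : ℂ) * g m = conv w g m) :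
    (∀ m, g m = g j * f m) ∧ (μ ≠ level D j w f → ∀ m, g m = 0) := by
  have hb := h.pos
  have hfj := hf.apply_self h hw
  have hzero : μ ≠ level D j w f → ∀ m, g m = 0 := by
    intro hne
    -- Eigenvectors of a symmetric operator for different eigenvalues are orthogonal.
    have horth : ∑' m, f m * starRingEnd ℂ (g m) = 0 := by
      have hsym := tsum_conv_mul_conj w.summable_norm hherm f.summable_norm hg
      have hs1 := (summable_mul_conj (SeqL1.conv w f).summable_norm hg).of_norm
      have hs2 := (summable_mul_conj f.summable_norm
        (norm_conv_le w.summable_norm hg)).of_norm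
      have h1 := (hs1.tsum_sub hs2).trans (sub_eq_zero.2 hsym)
      have h2 : ∀ m, SeqL1.conv w f m * starRingEnd ℂ (g m) - f m * starRingEnd ℂ (conv w g m) =
          ((level D j w f - μ : ℝ) : ℂ) * (f m * starRingEnd ℂ (g m)) := by
        intro m
        rw [← he m, show SeqL1.conv w f m = conv w f m from rfl, ← hf.eigen h hw hherm m, map_mul,
          Complex.conj_ofReal]
        push_cast
        ring
      simp only [h2] at h1
      rw [tsum_mul_left, mul_eq_zero, Complex.ofReal_eq_zero, sub_eq_zero] at h1
      exact h1.resolve_left hne.symm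
    have hdist : ‖SeqL1.basis j - f‖ ≤ 1 / 2 := by
      have h0 : 64 * ‖(0 : SeqL1 n)‖ ≤ b := by simpa using hb.le
      refine ((isState_basis h).norm_sub_le h h0 hw hf).trans ?_
      rw [zero_sub, norm_neg, div_mul_eq_mul_div, div_le_iff₀ hb]
      linarith [norm_nonneg w]
    refine eq_zero_of_forall_norm_le_half hg fun C' hC' hg' m => ?_
    rcases ne_or_eq m j with hm | rfl
    · exact norm_le_half_of_eigen h hw hμ hC' hg' hm (he m)
    -- At the isolated index the gap is of no use. Orthogonality to `f` lets `e_j - f` replace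
    -- `e_j`, and its norm is at most `1/2`.
    · have hs1 := (summable_mul_conj (SeqL1.basis m).summable_norm hg').of_norm
      have hs2 := (summable_mul_conj f.summable_norm hg').of_norm
      have hs3 := summable_mul_conj (SeqL1.basis m - f).summable_norm hg'
      have h1 : starRingEnd ℂ (g m) = ∑' q, SeqL1.basis m q * starRingEnd ℂ (g q) := by
        rw [tsum_eq_single m]
        · rw [SeqL1.basis_apply, if_pos rfl, one_mul]
        · intro q hq
          rw [SeqL1.basis_apply, if_neg hq, zero_mul]
      have h2 : starRingEnd ℂ (g m) =
          ∑' q, (SeqL1.basis m - f) q * starRingEnd ℂ (g q) := by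
        rw [← sub_zero (starRingEnd ℂ (g m)), ← horth, h1, ← hs1.tsum_sub hs2]
        refine tsum_congr fun q => ?_
        rw [lp.coeFn_sub, Pi.sub_apply, sub_mul]
      rw [← RCLike.norm_conj, h2]
      calc _ ≤ ∑' q, ‖(SeqL1.basis m - f) q * starRingEnd ℂ (g q)‖ := norm_tsum_le_tsum_norm hs3
        _ ≤ ∑' q, ‖(SeqL1.basis m - f) q‖ * C' := by
          refine hs3.tsum_le_tsum (fun q => ?_) ((SeqL1.summable_norm _).mul_right _)
          rw [norm_mul, RCLike.norm_conj]
          gcongr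
          exact hg' q
        _ = ‖SeqL1.basis m - f‖ * C' := by rw [tsum_mul_right, ← SeqL1.norm_eq]
        _ ≤ C' / 2 := by nlinarith
  refine ⟨fun m => ?_, hzero⟩
  by_cases hne : μ = level D j w f
  · have hgf : ∀ m, ‖g j * f m‖ ≤ ‖g j‖ * 2 := fun m => by
      rw [norm_mul]
      gcongr
      exact (f.norm_apply_le m).trans hf.norm_le
    -- The difference `g - g_j f` solves the same equation and vanishes at `j`, so the halving
    -- argument applies to it.
    have hd : ∀ m, ‖(g - fun m => g j * f m) m‖ ≤ C + ‖g j‖ * 2 := fun m =>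
      (_root_.norm_sub_le _ _).trans (add_le_add (hg m) (hgf m))
    have hed : ∀ m, ((μ - D m : ℝ) : ℂ) * (g - fun m => g j * f m) m =
        conv w (g - fun m => g j * f m) m := by
      intro m
      rw [conv_sub_right w.summable_norm hg hgf, conv_smul_right, ← he, ← hf.eigen h hw hherm, hne,
        Pi.sub_apply]
      ring
    have h0 := eq_zero_of_forall_norm_le_half hd (fun C' hC' hg' m => ?_) m
    · exact sub_eq_zero.1 h0
    rcases ne_or_eq m j with hm | rfl
    · exact norm_le_half_of_eigen h hw hμ hC' hg' hm (hed m)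
    · rw [Pi.sub_apply, hfj, mul_one, sub_self, norm_zero]
      positivity
  · rw [hzero hne m, hzero hne j, zero_mul]

/-! ### The normalized state -/

/-- `∑_m |f_m|²`. -/
def normSqSum (f : SeqL1 n) : ℝ := ∑' m, ‖f m‖ ^ 2

/-- The column `f_m / ∑_q |f_q|²` of the orthogonal projection onto the line of `f`. -/
def projColumn (f : SeqL1 n) : SeqL1 n := (((normSqSum f)⁻¹ : ℝ) : ℂ) • f

theorem summable_norm_sq (f : SeqL1 n) : Summable fun m => ‖f m‖ ^ 2 := by
  refine Summable.of_nonneg_of_le (fun _ => by positivity) (fun m => ?_)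
    (f.summable_norm.mul_left ‖f‖)
  rw [pow_two]
  exact mul_le_mul_of_nonneg_right (f.norm_apply_le m) (norm_nonneg _)

theorem one_le_normSqSum {f : SeqL1 n} (hf : f j = 1) : 1 ≤ normSqSum f := by
  have := (summable_norm_sq f).le_tsum j fun _ _ => by positivity
  simpa [hf, normSqSum] using this

theorem abs_normSqSum_sub_le {f g : SeqL1 n} (hf : ‖f‖ ≤ 2) (hg : ‖g‖ ≤ 2) :
    |normSqSum f - normSqSum g| ≤ 4 * ‖f - g‖ := by
  have hs : Summable fun m => ‖f m‖ ^ 2 - ‖g m‖ ^ 2 := (summable_norm_sq f).sub (summable_norm_sq g)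
  have hle : ∀ m, ‖‖f m‖ ^ 2 - ‖g m‖ ^ 2‖ ≤ 4 * ‖(f - g) m‖ := by
    intro m
    rw [sq_sub_sq, norm_mul, lp.coeFn_sub, Pi.sub_apply]
    have h1 := (f.norm_apply_le m).trans hf
    have h2 := (g.norm_apply_le m).trans hg
    refine mul_le_mul ?_ (abs_norm_sub_norm_le _ _) (norm_nonneg _) (by norm_num)
    rw [Real.norm_of_nonneg (by positivity)]
    linarith
  have hs' := Summable.of_nonneg_of_le (fun _ => norm_nonneg _) hle
    ((f - g).summable_norm.mul_left 4)
  rw [normSqSum, normSqSum, ← (summable_norm_sq f).tsum_sub (summable_norm_sq g),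
    ← Real.norm_eq_abs, (f - g).norm_eq, ← tsum_mul_left]
  exact (norm_tsum_le_tsum_norm hs').trans
    (hs'.tsum_le_tsum hle ((f - g).summable_norm.mul_left 4))

theorem norm_projColumn_le {f : SeqL1 n} (hfj : f j = 1) (hf : ‖f‖ ≤ 2) : ‖projColumn f‖ ≤ 2 := by
  have h1 := one_le_normSqSum hfj
  rw [projColumn, norm_smul, Complex.norm_real, Real.norm_of_nonneg (by positivity)]
  have h2 : (normSqSum f)⁻¹ ≤ 1 := inv_le_one_of_one_le₀ h1
  have h3 : 0 ≤ (normSqSum f)⁻¹ := by positivity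
  nlinarith [norm_nonneg f]

/-- Since `f_j = g_j = 1`, the normalizing sums are at least 1, so inversion does not enlarge their
difference. The constant is `1 + 4·2`. -/
theorem norm_projColumn_sub_le {f g : SeqL1 n} (hfj : f j = 1) (hgj : g j = 1) (hf : ‖f‖ ≤ 2)
    (hg : ‖g‖ ≤ 2) : ‖projColumn f - projColumn g‖ ≤ 9 * ‖f - g‖ := by
  have h1 := one_le_normSqSum hfj
  have h2 := one_le_normSqSum hgj
  have h3 := abs_normSqSum_sub_le hf hg
  set N := normSqSum f with hN
  set N' := normSqSum g with hN'
  have he : projColumn f - projColumn g =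
      ((N⁻¹ : ℝ) : ℂ) • (f - g) + ((N⁻¹ - N'⁻¹ : ℝ) : ℂ) • g := by
    rw [projColumn, projColumn, ← hN, ← hN', smul_sub, Complex.ofReal_sub, sub_smul]
    abel
  have h4 : N⁻¹ ≤ 1 := inv_le_one_of_one_le₀ h1
  have h5 : |N⁻¹ - N'⁻¹| ≤ 4 * ‖f - g‖ := by
    rw [inv_sub_inv (by positivity) (by positivity), abs_div, abs_sub_comm,
      abs_of_pos (a := N * N') (by positivity)]
    exact (div_le_self (abs_nonneg _) (by nlinarith)).trans h3
  rw [he]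
  refine (norm_add_le _ _).trans ?_
  rw [norm_smul, norm_smul, Complex.norm_real, Complex.norm_real, Real.norm_eq_abs,
    Real.norm_eq_abs, abs_of_pos (a := N⁻¹) (by positivity)]
  have h6 := norm_nonneg (f - g)
  have h7 : N⁻¹ * ‖f - g‖ ≤ 1 * ‖f - g‖ := by gcongr
  have h8 : |N⁻¹ - N'⁻¹| * ‖g‖ ≤ 4 * ‖f - g‖ * 2 := by gcongr
  linarith

theorem projColumn_basis (j : Fin n → ℤ) : projColumn (SeqL1.basis j) = SeqL1.basis j := by
  have : normSqSum (SeqL1.basis j) = 1 := by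
    rw [normSqSum, tsum_eq_single j]
    · simp [SeqL1.basis_apply]
    · intro m hm
      simp [SeqL1.basis_apply, hm]
  rw [projColumn, this]
  simp

theorem IsState.norm_projColumn_sub_le (h : IsIsolatedLevel D E b j) {w w' f f' : SeqL1 n}
    (hw : 64 * ‖w‖ ≤ b) (hw' : 64 * ‖w'‖ ≤ b) (hf : IsState D j w f) (hf' : IsState D j w' f') :
    ‖projColumn f - projColumn f'‖ ≤ 72 / b * ‖w - w'‖ := by
  have h1 := Polyharmonic.norm_projColumn_sub_le (hf.apply_self h hw) (hf'.apply_self h hw')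
    hf.norm_le hf'.norm_le
  have h2 := hf.norm_sub_le h hw hw' hf'
  have h3 : 72 / b * ‖w - w'‖ = 9 * (8 / b * ‖w - w'‖) := by ring
  linarith

end

section

/-! ### The spectral projection of the Bloch operator -/

theorem memLp_ofReal {W : Space n → ℝ} {p : ℝ≥0∞} (hW : MemLp W p (cellMeasure n)) :
    MemLp (fun x => (W x : ℂ)) p (cellMeasure n) := hW.ofReal

theorem ae_eq_waveSum_fourierCoef {W : Space n → ℝ} (hW : MemLp W ∞ (cellMeasure n))
    (hs : Summable fun q => ‖fourierCoef W q‖) :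
    (fun x => (W x : ℂ)) =ᵐ[cellMeasure n] waveSum 0 (fourierCoef W) :=
  eq_waveSum_of_summable_blochCoeff ((memLp_ofReal hW).mono_exponent le_top) 0 hs

theorem memLp_potential_mul {W : Space n → ℝ} (hW : MemLp W ∞ (cellMeasure n)) (u : L2Cell n) :
    MemLp (fun x => (W x : ℂ) * u x) 2 (cellMeasure n) :=
  (Lp.memLp u).mul (memLp_ofReal hW)

theorem blochCoeff_potential_mul {W : Space n → ℝ} (hW : MemLp W ∞ (cellMeasure n))
    (hs : Summable fun q => ‖fourierCoef W q‖) (t : Space n) (u : L2Cell n) (m : Fin n → ℤ) :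
    blochCoeff t (fun x => (W x : ℂ) * u x) m = conv (fourierCoef W) (blochCoeff t u) m := by
  rw [← blochCoeff_waveSum_mul hs ((Lp.memLp u).integrable one_le_two) 0 t m, zero_add]
  refine blochCoeff_congr ?_ t m
  filter_upwards [ae_eq_waveSum_fourierCoef hW hs] with x hx
  rw [hx]

/-- Testing against `ψ_m` makes `(-Δ)ˡ` diagonal and multiplication by `W` a convolution. This is
the passage from the operator in `L²(Q)` to sequences. -/
theorem mem_blochEigenspace_iff {l : ℕ} {t : Space n} {W : Space n → ℝ}
    (hW : MemLp W ∞ (cellMeasure n)) (hs : Summable fun q => ‖fourierCoef W q‖) {μ : ℝ}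
    {u : L2Cell n} : u ∈ blochEigenspace l t W μ ↔
      ∀ m, ((μ - ‖pvec t m‖ ^ (2 * l) : ℝ) : ℂ) * blochCoeff t u m =
        conv (fourierCoef W) (blochCoeff t u) m := by
  have h2 : (((2 * Real.pi : ℝ) : ℂ)⁻¹ ^ n) ≠ 0 :=
    pow_ne_zero _ (inv_ne_zero (Complex.ofReal_ne_zero.2 (by positivity)))
  have hmem : u ∈ blochEigenspace l t W μ ↔ IsBlochImage l t W u ((μ : ℂ) • u) := Iff.rfl
  rw [hmem, IsBlochImage, and_iff_right (memLp_potential_mul hW u)]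
  refine forall_congr' fun m => ?_
  have e1 : ∫ x in cell n, u x * starRingEnd ℂ (polyLaplacian l (planeWave t m) x) =
      ((‖pvec t m‖ ^ (2 * l) : ℝ) : ℂ) * ∫ x in cell n, u x * starRingEnd ℂ (planeWave t m x) := by
    rw [polyLaplacian_planeWave, ← integral_const_mul]
    refine integral_congr_ae (Filter.Eventually.of_forall fun x => ?_)
    simp only [map_mul, Complex.conj_ofReal]
    ring
  have e2 : ∫ x in cell n, ((μ : ℂ) • u : L2Cell n) x * starRingEnd ℂ (planeWave t m x) =
      (μ : ℂ) * ∫ x in cell n, u x * starRingEnd ℂ (planeWave t m x) := by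
    rw [← integral_const_mul]
    refine integral_congr_ae ?_
    filter_upwards [Lp.coeFn_smul (μ : ℂ) u] with x hx
    rw [hx, Pi.smul_apply, smul_eq_mul, mul_assoc]
  rw [e1, e2, ← blochCoeff_potential_mul hW hs, ← mul_right_inj' h2, blochCoeff, blochCoeff]
  constructor
  · intro h
    push_cast at h ⊢
    linear_combination -h
  · intro h
    push_cast at h ⊢
    linear_combination -h

/-- The function `∑_m f_m ψ_m` in `L²(Q)`. -/
def waveSumLp (t : Space n) (f : SeqL1 n) : L2Cell n :=
  (memLp_waveSum f.summable_norm t 2).toLp (waveSum t f)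

theorem coeFn_waveSumLp (t : Space n) (f : SeqL1 n) :
    (waveSumLp t f : Space n → ℂ) =ᵐ[cellMeasure n] waveSum t f :=
  MemLp.coeFn_toLp _

theorem blochCoeff_waveSumLp (t : Space n) (f : SeqL1 n) :
    blochCoeff t (waveSumLp t f) = f := by
  funext m
  rw [blochCoeff_congr (coeFn_waveSumLp t f), blochCoeff_waveSum f.summable_norm]

theorem blochCoeff_smul (t : Space n) (c : ℂ) (u : L2Cell n) (m : Fin n → ℤ) :
    blochCoeff t ((c • u : L2Cell n) : Space n → ℂ) m = c * blochCoeff t u m := by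
  rw [blochCoeff_congr (Lp.coeFn_smul c u)]
  exact blochCoeff_const_mul c u t m

theorem L2Cell.ext_blochCoeff {t : Space n} {u v : L2Cell n}
    (h : ∀ m, blochCoeff t u m = blochCoeff t v m) : u = v := by
  have h1 := ae_eq_zero_of_blochCoeff_eq_zero ((Lp.memLp u).sub (Lp.memLp v)) t fun m =>
    (blochCoeff_sub ((Lp.memLp u).integrable one_le_two)
      ((Lp.memLp v).integrable one_le_two) t m).trans (sub_eq_zero.2 (h m))
  refine Lp.ext ?_
  filter_upwards [h1] with x hx
  exact sub_eq_zero.1 hx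

/-- The coefficients of `conj (∑ a_m ψ_m)`. -/
def SeqL1.conjRev (a : SeqL1 n) : SeqL1 n :=
  SeqL1.mk (fun m => starRingEnd ℂ (a (-m))) (by
    simpa [Function.comp_def] using (Equiv.neg (Fin n → ℤ)).summable_iff.2 a.summable_norm)

theorem SeqL1.conjRev_apply (a : SeqL1 n) (m : Fin n → ℤ) :
    a.conjRev m = starRingEnd ℂ (a (-m)) := rfl

theorem SeqL1.norm_conjRev (a : SeqL1 n) : ‖a.conjRev‖ = ‖a‖ := by
  rw [SeqL1.norm_eq, SeqL1.norm_eq, ← (Equiv.neg _).tsum_eq]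
  simp [SeqL1.conjRev_apply]

theorem SeqL1.conjRev_sub (a b : SeqL1 n) : (a - b).conjRev = a.conjRev - b.conjRev := by
  ext m
  simp [SeqL1.conjRev_apply]

/-- The coefficients of `|∑ a_m ψ_m|²`. -/
def SeqL1.autocorr (a : SeqL1 n) : SeqL1 n := SeqL1.conv a.conjRev a

theorem fourierCoef_norm_sq_waveSum (t : Space n) (a : SeqL1 n) (q : Fin n → ℤ) :
    fourierCoef (fun x => ‖waveSum t a x‖ ^ 2) q = a.autocorr q := by
  -- Conjugation changes the quasimomentum to `-t`, so the quasimomenta cancel in `|u|²`.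
  have h := blochCoeff_waveSum_mul a.conjRev.summable_norm
    ((memLp_waveSum a.summable_norm t 2).integrable one_le_two) (-t) t q
  have h1 : blochCoeff t (waveSum t a) = a :=
    funext fun m => blochCoeff_waveSum a.summable_norm t m
  rw [neg_add_cancel, h1] at h
  rw [fourierCoef, SeqL1.autocorr, SeqL1.conv, SeqL1.coe_mk, ← h]
  congr 1
  funext x
  have h2 : waveSum (-t) a.conjRev x = starRingEnd ℂ (waveSum t a x) := (conj_waveSum t a x).symm
  rw [h2, Complex.conj_mul', Complex.ofReal_pow]

/-- With `fourierCoef_norm_sq_waveSum` this is Parseval's identity, used in `norm_sq_waveSumLp`. -/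
theorem SeqL1.autocorr_zero (a : SeqL1 n) : a.autocorr 0 = normSqSum a := by
  rw [SeqL1.autocorr, SeqL1.conv, SeqL1.coe_mk, Polyharmonic.conv, normSqSum, Complex.ofReal_tsum,
    ← (Equiv.neg _).tsum_eq]
  refine tsum_congr fun q => ?_
  simp only [SeqL1.conjRev_apply, Equiv.neg_apply, neg_neg, zero_sub]
  rw [Complex.conj_mul', Complex.ofReal_pow]

theorem integral_eq_mul_blochCoeff (t : Space n) (u : Space n → ℂ) (m : Fin n → ℤ) :
    ∫ x in cell n, u x * starRingEnd ℂ (planeWave t m x) =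
      ((2 * Real.pi : ℝ) : ℂ) ^ n * blochCoeff t u m := by
  have h2 : ((2 * Real.pi : ℝ) : ℂ) ≠ 0 := Complex.ofReal_ne_zero.2 (by positivity)
  rw [blochCoeff, ← mul_assoc, inv_pow, mul_inv_cancel₀ (pow_ne_zero _ h2), one_mul]

theorem norm_sq_waveSumLp (t : Space n) (f : SeqL1 n) :
    ‖waveSumLp t f‖ ^ 2 = (2 * Real.pi) ^ n * normSqSum f := by
  have h := @inner_self_eq_norm_sq_to_K ℂ _ _ _ _ (waveSumLp t f)
  rw [L2.inner_def] at h
  have h1 : ∫ x in cell n, inner ℂ (waveSumLp t f x) (waveSumLp t f x) =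
      ∫ x in cell n, ((‖waveSum t f x‖ ^ 2 : ℝ) : ℂ) * starRingEnd ℂ (planeWave 0 0 x) := by
    refine integral_congr_ae ?_
    filter_upwards [coeFn_waveSumLp t f] with x hx
    rw [hx, planeWave_zero_zero, map_one, mul_one, inner_self_eq_norm_sq_to_K]
    simp
  rw [h1, integral_eq_mul_blochCoeff 0 (fun x => ((‖waveSum t f x‖ ^ 2 : ℝ) : ℂ))] at h
  have h3 := fourierCoef_norm_sq_waveSum t f 0
  rw [fourierCoef] at h3
  rw [h3, SeqL1.autocorr_zero] at h
  have h4 : (((2 * Real.pi) ^ n * normSqSum f : ℝ) : ℂ) = ((‖waveSumLp t f‖ ^ 2 : ℝ) : ℂ) := by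
    push_cast at h ⊢
    exact h
  exact (Complex.ofReal_injective h4).symm

theorem inner_waveSumLp_planeWave (t : Space n) (f : SeqL1 n) (j : Fin n → ℤ) :
    inner ℂ (waveSumLp t f) ((memLp_planeWave t j).toLp (planeWave t j)) =
      ((2 * Real.pi : ℝ) : ℂ) ^ n * starRingEnd ℂ (f j) := by
  have h := integral_eq_mul_blochCoeff t (waveSumLp t f) j
  rw [blochCoeff_waveSumLp] at h
  have h2 := congrArg (starRingEnd ℂ) h
  rw [← integral_conj, map_mul, map_pow, Complex.conj_ofReal] at h2
  rw [← h2, L2.inner_def]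
  refine integral_congr_ae ?_
  filter_upwards [(memLp_planeWave t j).coeFn_toLp] with x hx
  rw [hx, RCLike.inner_apply, map_mul, Complex.conj_conj]
  ring

theorem mem_energyWindow_iff {l : ℕ} {k δ μ : ℝ} : μ ∈ energyWindow n l k δ ↔
    |μ - k ^ (2 * l)| < k ^ (2 * (l : ℝ) - n - δ) := by
  rw [energyWindow, mem_Ioo, abs_lt]
  constructor <;> rintro ⟨h1, h2⟩ <;> constructor <;> linarith

/-- The data of the perturbation problem: a bounded potential `W` with absolutely summable
coefficients `w`, small with respect to the gap around the isolated level `j`. -/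
structure IsPerturbation (l : ℕ) (k δ : ℝ) (t : Space n) (j : Fin n → ℤ) (W : Space n → ℝ)
    (w : SeqL1 n) : Prop where
  isolated : IsIsolatedLevel (fun m => ‖pvec t m‖ ^ (2 * l)) (k ^ (2 * l))
    (k ^ (2 * (l : ℝ) - n - δ)) j
  small : 64 * ‖w‖ ≤ k ^ (2 * (l : ℝ) - n - δ)
  memLp : MemLp W ∞ (cellMeasure n)
  coef : fourierCoef W = w

variable {l : ℕ} {k δ : ℝ} {t : Space n} {j : Fin n → ℤ} {W : Space n → ℝ} {w f : SeqL1 n}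

/-- The free eigenvalues `|p_m(t)|²ˡ`. -/
abbrev freeLevel (l : ℕ) (t : Space n) (m : Fin n → ℤ) : ℝ := ‖pvec t m‖ ^ (2 * l)

theorem IsPerturbation.summable (h : IsPerturbation l k δ t j W w) :
    Summable fun q => ‖fourierCoef W q‖ := by
  rw [h.coef]
  exact w.summable_norm

theorem IsPerturbation.isHermitianSeq (h : IsPerturbation l k δ t j W w) : IsHermitianSeq w := by
  intro q
  rw [← h.coef]
  exact fourierCoef_neg W q

theorem IsPerturbation.waveSumLp_mem (h : IsPerturbation l k δ t j W w)
    (hf : IsState (freeLevel l t) j w f) :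
    waveSumLp t f ∈ blochEigenspace l t W (level (freeLevel l t) j w f) := by
  rw [mem_blochEigenspace_iff h.memLp h.summable, blochCoeff_waveSumLp, h.coef]
  exact fun m => hf.eigen h.isolated h.small h.isHermitianSeq m

/-- The coefficients of any element of `L²(Q)` are bounded by a multiple of its `L¹` norm, which is
all that `IsState.eq_smul_of_eigen` needs. -/
theorem IsPerturbation.eq_smul_of_mem (h : IsPerturbation l k δ t j W w)
    (hf : IsState (freeLevel l t) j w f) {μ : ℝ} (hμ : μ ∈ energyWindow n l k δ) {u : L2Cell n}
    (hu : u ∈ blochEigenspace l t W μ) : u = blochCoeff t u j • waveSumLp t f ∧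
      (μ ≠ level (freeLevel l t) j w f → u = 0) := by
  rw [mem_blochEigenspace_iff h.memLp h.summable, h.coef] at hu
  have h1 := hf.eq_smul_of_eigen h.isolated h.small h.isHermitianSeq
    (mem_energyWindow_iff.1 hμ).le (norm_blochCoeff_le u t) hu
  have h3 : u = blochCoeff t u j • waveSumLp t f := by
    refine L2Cell.ext_blochCoeff (t := t) fun m => ?_
    rw [blochCoeff_smul, blochCoeff_waveSumLp]
    exact h1.1 m
  refine ⟨h3, fun hne => ?_⟩
  rw [h3, h1.2 hne j, zero_smul]

theorem IsPerturbation.level_mem (h : IsPerturbation l k δ t j W w)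
    (hf : IsState (freeLevel l t) j w f) :
    level (freeLevel l t) j w f ∈ energyWindow n l k δ := by
  rw [mem_energyWindow_iff]
  have h1 := abs_level_sub_le h.isolated h.small hf.norm_le
  have h2 := h.isolated.pos
  exact h1.trans_lt (by linarith)

theorem IsPerturbation.waveSumLp_ne_zero (h : IsPerturbation l k δ t j W w)
    (hf : IsState (freeLevel l t) j w f) : waveSumLp t f ≠ 0 := by
  intro h0
  have h1 := norm_sq_waveSumLp t f
  have h2 := one_le_normSqSum (hf.apply_self h.isolated h.small)
  have h3 : 0 < (2 * Real.pi) ^ n * normSqSum f := by positivity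
  rw [h0, norm_zero, zero_pow two_ne_zero] at h1
  linarith

theorem IsPerturbation.blochEigenspace_eq (h : IsPerturbation l k δ t j W w)
    (hf : IsState (freeLevel l t) j w f) :
    blochEigenspace l t W (level (freeLevel l t) j w f) = Submodule.span ℂ {waveSumLp t f} := by
  refine le_antisymm (fun u hu => ?_) ?_
  · rw [(h.eq_smul_of_mem hf (h.level_mem hf) hu).1]
    exact Submodule.smul_mem _ _ (Submodule.mem_span_singleton_self _)
  · rw [Submodule.span_singleton_le_iff_mem]
    exact h.waveSumLp_mem hf

theorem IsPerturbation.blochEigenspace_eq_bot (h : IsPerturbation l k δ t j W w)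
    (hf : IsState (freeLevel l t) j w f) {μ : ℝ} (hμ : μ ∈ energyWindow n l k δ)
    (hne : μ ≠ level (freeLevel l t) j w f) : blochEigenspace l t W μ = ⊥ := by
  rw [Submodule.eq_bot_iff]
  exact fun u hu => (h.eq_smul_of_mem hf hμ hu).2 hne

theorem IsPerturbation.hasUniqueSimpleEigenvalue (h : IsPerturbation l k δ t j W w)
    (hf : IsState (freeLevel l t) j w f) : HasUniqueSimpleEigenvalue l k δ t W := by
  refine ⟨_, h.level_mem hf, ?_, fun μ hμ hbot => ?_⟩
  · rw [h.blochEigenspace_eq hf]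
    exact finrank_span_singleton (h.waveSumLp_ne_zero hf)
  · by_contra hne
    exact hbot (h.blochEigenspace_eq_bot hf hμ hne)

theorem IsPerturbation.spectralSubspace_eq (h : IsPerturbation l k δ t j W w)
    (hf : IsState (freeLevel l t) j w f) :
    spectralSubspace l k δ t W = Submodule.span ℂ {waveSumLp t f} := by
  have h1 : (⨆ lam ∈ energyWindow n l k δ, blochEigenspace l t W lam) =
      Submodule.span ℂ {waveSumLp t f} := by
    rw [← h.blochEigenspace_eq hf]
    refine le_antisymm (iSup₂_le fun μ hμ => ?_) ?_
    · by_cases hne : μ = level (freeLevel l t) j w f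
      · rw [hne]
      · rw [h.blochEigenspace_eq_bot hf hμ hne]
        exact bot_le
    · exact le_iSup₂_of_le _ (h.level_mem hf) le_rfl
  rw [spectralSubspace, h1]
  exact (Submodule.closed_of_finiteDimensional _).submodule_topologicalClosure_eq

/-- The equality is a hypothesis on a variable `K` so that it can be substituted together with the
instance that `starProjection` depends on. -/
theorem starProjection_of_eq_span_singleton {K : Submodule ℂ (L2Cell n)}
    [K.HasOrthogonalProjection] {v : L2Cell n} (hK : K = Submodule.span ℂ {v}) (u : L2Cell n) :
    K.starProjection u = (inner ℂ v u / ((‖v‖ ^ 2 : ℝ) : ℂ)) • v := by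
  subst hK
  exact Submodule.starProjection_singleton ℂ u

theorem IsPerturbation.projMatrix_eq (h : IsPerturbation l k δ t j W w)
    (hf : IsState (freeLevel l t) j w f) (m : Fin n → ℤ) :
    projMatrix l k δ t W m j = projColumn f m := by
  have h2 : (((2 * Real.pi : ℝ) : ℂ) ^ n) ≠ 0 :=
    pow_ne_zero _ (Complex.ofReal_ne_zero.2 (by positivity))
  have h3 := one_le_normSqSum (hf.apply_self h.isolated h.small)
  have h4 : ((normSqSum f : ℝ) : ℂ) ≠ 0 := Complex.ofReal_ne_zero.2 (by positivity)
  have : CompleteSpace (spectralSubspace l k δ t W) :=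
    Submodule.topologicalClosure.completeSpace _
  have h1 := starProjection_of_eq_span_singleton (h.spectralSubspace_eq hf)
    ((memLp_planeWave t j).toLp (planeWave t j))
  -- The inner product is `(2π)ⁿ conj f_j = (2π)ⁿ` and the squared norm is `(2π)ⁿ ∑|f_q|²`.
  rw [projMatrix, spectralProjection, h1, blochCoeff_smul, blochCoeff_waveSumLp,
    inner_waveSumLp_planeWave, norm_sq_waveSumLp, hf.apply_self h.isolated h.small, projColumn,
    lp.coeFn_smul, Pi.smul_apply, smul_eq_mul, map_one, mul_one]
  push_cast at h2 h4 ⊢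
  congr 1
  field_simp

end

section

/-! ### The potentials `V + σ |A ∑ a_m ψ_m|²` -/

theorem planeWave_add_period (t : Space n) (m : Fin n → ℤ) (x : Space n) (i : Fin n) :
    planeWave t m (x + EuclideanSpace.single i (2 * Real.pi)) =
      Complex.exp (2 * Real.pi * t i * Complex.I) * planeWave t m x := by
  rw [planeWave, planeWave, inner_add_right, ← Complex.exp_add]
  have h1 : inner ℝ (pvec t m) (EuclideanSpace.single i (2 * Real.pi)) =
      2 * Real.pi * (t i + m i) := by
    simp [EuclideanSpace.inner_single_right, pvec]
  rw [h1, ← mul_one (Complex.exp (_ + _)), ← Complex.exp_int_mul_two_pi_mul_I (m i),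
    ← Complex.exp_add]
  congr 1
  push_cast
  ring

/-- All `ψ_m` acquire the same unimodular factor under a period. -/
theorem norm_waveSum_add_period (t : Space n) (a : (Fin n → ℤ) → ℂ) (x : Space n) (i : Fin n) :
    ‖waveSum t a (x + EuclideanSpace.single i (2 * Real.pi))‖ = ‖waveSum t a x‖ := by
  have h1 : waveSum t a (x + EuclideanSpace.single i (2 * Real.pi)) =
      Complex.exp (2 * Real.pi * t i * Complex.I) * waveSum t a x := by
    rw [waveSum, waveSum, ← tsum_mul_left]
    refine tsum_congr fun m => ?_
    rw [planeWave_add_period]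
    ring
  have h2 := Complex.norm_exp_ofReal_mul_I (2 * Real.pi * t i)
  push_cast at h2
  rw [h1, norm_mul, h2, one_mul]

/-- The potential `V + σ |A ∑ a_m ψ_m|²`. -/
def wavePotential (V : Space n → ℝ) (σ : ℝ) (A : ℂ) (t : Space n) (a : SeqL1 n) (x : Space n) : ℝ :=
  V x + σ * ‖A * waveSum t a x‖ ^ 2

variable {V W : Space n → ℝ} {σ : ℝ} {A : ℂ} {t : Space n}

theorem wavePotential_eq (V : Space n → ℝ) (σ : ℝ) (A : ℂ) (t : Space n) (a : SeqL1 n) :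
    wavePotential V σ A t a = fun x => V x + (σ * ‖A‖ ^ 2) * ‖waveSum t a x‖ ^ 2 := by
  funext x
  rw [wavePotential, norm_mul, mul_pow, mul_assoc]

theorem isCellPeriodic_wavePotential (hV : IsCellPeriodic V) (σ : ℝ) (A : ℂ) (t : Space n)
    (a : SeqL1 n) : IsCellPeriodic (wavePotential V σ A t a) := by
  intro x i
  rw [wavePotential_eq]
  simp only [hV x i, norm_waveSum_add_period]

theorem memLp_norm_sq_waveSum (t : Space n) (a : SeqL1 n) :
    MemLp (fun x => ‖waveSum t a x‖ ^ 2) ∞ (cellMeasure n) := by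
  refine memLp_top_of_bound ((continuous_waveSum a.summable_norm t).norm.pow 2).aestronglyMeasurable
    (‖a‖ ^ 2) (Filter.Eventually.of_forall fun x => ?_)
  rw [norm_pow, norm_norm, a.norm_eq]
  exact pow_le_pow_left₀ (norm_nonneg _) (norm_waveSum_le a.summable_norm t x) 2

theorem memLp_wavePotential (hV : MemLp V ∞ (cellMeasure n)) (σ : ℝ) (A : ℂ) (t : Space n)
    (a : SeqL1 n) : MemLp (wavePotential V σ A t a) ∞ (cellMeasure n) := by
  rw [wavePotential_eq]
  exact hV.add ((memLp_norm_sq_waveSum t a).const_mul _)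

theorem integrable_ofReal (hW : MemLp W ∞ (cellMeasure n)) :
    Integrable (fun x => (W x : ℂ)) (cellMeasure n) :=
  (memLp_ofReal hW).integrable le_top

theorem fourierCoef_sub {W W' : Space n → ℝ} (hW : MemLp W ∞ (cellMeasure n))
    (hW' : MemLp W' ∞ (cellMeasure n)) (q : Fin n → ℤ) :
    fourierCoef (W - W') q = fourierCoef W q - fourierCoef W' q := by
  rw [fourierCoef, fourierCoef, fourierCoef,
    ← blochCoeff_sub (integrable_ofReal hW) (integrable_ofReal hW')]
  simp only [Pi.sub_apply, Complex.ofReal_sub]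

theorem fourierCoef_const_mul (c : ℝ) (W : Space n → ℝ) (q : Fin n → ℤ) :
    fourierCoef (fun x => c * W x) q = c * fourierCoef W q := by
  rw [fourierCoef, fourierCoef, ← blochCoeff_const_mul]
  simp only [Complex.ofReal_mul]

theorem fourierCoef_const (c : ℝ) (q : Fin n → ℤ) :
    fourierCoef (fun _ : Space n => c) q = if q = 0 then (c : ℂ) else 0 := by
  have h := blochCoeff_const_mul (c : ℂ) (planeWave (0 : Space n) 0) 0 q
  simp only [planeWave_zero_zero, mul_one, blochCoeff_planeWave] at h
  rw [fourierCoef, h]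
  simp

theorem fourierCoef_wavePotential (hV : MemLp V ∞ (cellMeasure n)) (a : SeqL1 n)
    (q : Fin n → ℤ) : fourierCoef (wavePotential V σ A t a) q =
      fourierCoef V q + ((σ * ‖A‖ ^ 2 : ℝ) : ℂ) * a.autocorr q := by
  have h := fourierCoef_sub (memLp_wavePotential hV σ A t a) hV q
  have h1 : wavePotential V σ A t a - V = fun x => (σ * ‖A‖ ^ 2) * ‖waveSum t a x‖ ^ 2 := by
    rw [wavePotential_eq]
    funext x
    simp
  rw [h1, fourierCoef_const_mul, fourierCoef_norm_sq_waveSum] at h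
  rw [h]
  ring

theorem memLp_zeroMean (hW : MemLp W ∞ (cellMeasure n)) :
    MemLp (zeroMean W) ∞ (cellMeasure n) :=
  hW.sub (memLp_const _)

theorem fourierCoef_zeroMean (hW : MemLp W ∞ (cellMeasure n)) (q : Fin n → ℤ) :
    fourierCoef (zeroMean W) q = if q = 0 then 0 else fourierCoef W q := by
  have h1 := fourierCoef_sub hW (memLp_const (((2 * Real.pi) ^ n)⁻¹ * ∫ y in cell n, W y)) q
  have h2 : fourierCoef (zeroMean W) q = _ := h1
  rw [h2, fourierCoef_const]
  split_ifs with hq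
  · rw [hq, fourierCoef, blochCoeff]
    simp only [planeWave_zero_zero, map_one, mul_one, integral_complex_ofReal]
    push_cast
    rw [inv_pow, sub_self]
  · rw [sub_zero]

/-! ### The nonlinear map on sequences -/

/-- The sequence `x` with its zeroth term removed. -/
def SeqL1.meanFree (x : SeqL1 n) : SeqL1 n :=
  SeqL1.mk (fun q => if q = 0 then 0 else x q) (by
    refine Summable.of_nonneg_of_le (fun _ => norm_nonneg _) (fun q => ?_) x.summable_norm
    split_ifs
    · simp
    · exact le_rfl)

theorem SeqL1.meanFree_apply (x : SeqL1 n) (q : Fin n → ℤ) :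
    x.meanFree q = if q = 0 then 0 else x q := rfl

theorem SeqL1.norm_le_norm {x y : SeqL1 n} (h : ∀ m, ‖x m‖ ≤ ‖y m‖) : ‖x‖ ≤ ‖y‖ := by
  rw [x.norm_eq, y.norm_eq]
  exact x.summable_norm.tsum_le_tsum h y.summable_norm

theorem SeqL1.norm_meanFree_sub_le (x y : SeqL1 n) : ‖x.meanFree - y.meanFree‖ ≤ ‖x - y‖ := by
  refine SeqL1.norm_le_norm fun m => ?_
  simp only [lp.coeFn_sub, Pi.sub_apply, SeqL1.meanFree_apply]
  split_ifs <;> simp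

/-- The coefficients of `wavePotential`. -/
def potentialSeq (v : SeqL1 n) (s : ℝ) (a : SeqL1 n) : SeqL1 n := v + (s : ℂ) • a.autocorr

theorem potentialSeq_apply (v : SeqL1 n) (s : ℝ) (a : SeqL1 n) (q : Fin n → ℤ) :
    potentialSeq v s a q = v q + (s : ℂ) * a.autocorr q := by
  rw [potentialSeq, lp.coeFn_add, lp.coeFn_smul, Pi.add_apply, Pi.smul_apply, smul_eq_mul]

/-- The autocorrelation is quadratic, and 4 bounds `‖a‖ + ‖b‖`. -/
theorem norm_potentialSeq_sub_le (v : SeqL1 n) (s : ℝ) {a b : SeqL1 n} (ha : ‖a‖ ≤ 2)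
    (hb : ‖b‖ ≤ 2) : ‖potentialSeq v s a - potentialSeq v s b‖ ≤ 4 * |s| * ‖a - b‖ := by
  have h1 : potentialSeq v s a - potentialSeq v s b = (s : ℂ) • (a.autocorr - b.autocorr) := by
    rw [potentialSeq, potentialSeq, add_sub_add_left_eq_sub, smul_sub]
  have h2 : ‖a.autocorr - b.autocorr‖ ≤ 4 * ‖a - b‖ := by
    refine (SeqL1.norm_conv_sub_conv_le _ _ _ _).trans ?_
    rw [← SeqL1.conjRev_sub, SeqL1.norm_conjRev, SeqL1.norm_conjRev]
    nlinarith [norm_nonneg (a - b)]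
  rw [h1, norm_smul, Complex.norm_real, Real.norm_eq_abs]
  calc |s| * ‖a.autocorr - b.autocorr‖ ≤ |s| * (4 * ‖a - b‖) := by gcongr
    _ = _ := by ring

/-- The density `|ψ_j|² = 1` is constant. Hence the mean-free part of the initial potential does not
involve the coupling. -/
theorem autocorr_basis {j q : Fin n → ℤ} (hq : q ≠ 0) : (SeqL1.basis j).autocorr q = 0 := by
  have : ∀ p, (SeqL1.basis j).conjRev p * SeqL1.basis j (q - p) = 0 := by
    intro p
    rw [SeqL1.conjRev_apply, SeqL1.basis_apply, SeqL1.basis_apply]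
    by_cases h1 : -p = j
    · rw [if_neg (c := q - p = j), mul_zero]
      intro h2
      apply hq
      rw [← h1, sub_eq_neg_self] at h2
      exact h2
    · rw [if_neg h1, map_zero, zero_mul]
  rw [SeqL1.autocorr, SeqL1.conv, SeqL1.coe_mk, conv]
  simp only [this, tsum_zero]

/-- The coefficients of the mean-free part of `wavePotential`. -/
def meanFreeSeq (v : SeqL1 n) (s : ℝ) (a : SeqL1 n) : SeqL1 n := (potentialSeq v s a).meanFree

theorem norm_meanFreeSeq_basis_le (v : SeqL1 n) (s : ℝ) (j : Fin n → ℤ) :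
    ‖meanFreeSeq v s (SeqL1.basis j)‖ ≤ ‖v‖ := by
  refine SeqL1.norm_le_norm fun m => ?_
  rw [meanFreeSeq, SeqL1.meanFree_apply]
  split_ifs with hm
  · simp
  · rw [potentialSeq_apply, autocorr_basis hm, mul_zero, add_zero]

theorem norm_meanFreeSeq_sub_le (v : SeqL1 n) (s : ℝ) {a b : SeqL1 n} (ha : ‖a‖ ≤ 2)
    (hb : ‖b‖ ≤ 2) : ‖meanFreeSeq v s a - meanFreeSeq v s b‖ ≤ 4 * |s| * ‖a - b‖ :=
  (SeqL1.norm_meanFree_sub_le _ _).trans (norm_potentialSeq_sub_le v s ha hb)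

open Classical in
/-- The nonlinear map on the level of the columns of the spectral projections. -/
def columnMap (D : (Fin n → ℤ) → ℝ) (j : Fin n → ℤ) (v : SeqL1 n) (s : ℝ) (a : SeqL1 n) :
    SeqL1 n :=
  -- For a small mean-free part the state exists and is unique, so neither the choice nor the value
  -- 0 matters.
  if h : ∃ f, IsState D j (meanFreeSeq v s a) f then projColumn h.choose else 0

variable {D : (Fin n → ℤ) → ℝ} {E b : ℝ} {j : Fin n → ℤ} {v : SeqL1 n} {s R : ℝ}

theorem exists_columnMap_eq (h : IsIsolatedLevel D E b j) {a : SeqL1 n}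
    (ha : 64 * ‖meanFreeSeq v s a‖ ≤ b) :
    ∃ f, IsState D j (meanFreeSeq v s a) f ∧ columnMap D j v s a = projColumn f := by
  have hex := exists_isState h ha
  exact ⟨hex.choose, hex.choose_spec, by rw [columnMap, dif_pos hex]⟩

theorem norm_columnMap_sub_le (h : IsIsolatedLevel D E b j) {a a' : SeqL1 n}
    (ha : 64 * ‖meanFreeSeq v s a‖ ≤ b) (ha' : 64 * ‖meanFreeSeq v s a'‖ ≤ b) :
    ‖columnMap D j v s a - columnMap D j v s a'‖ ≤
      72 / b * ‖meanFreeSeq v s a - meanFreeSeq v s a'‖ := by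
  obtain ⟨f, hf, he⟩ := exists_columnMap_eq h ha
  obtain ⟨f', hf', he'⟩ := exists_columnMap_eq h ha'
  rw [he, he']
  exact hf.norm_projColumn_sub_le h ha ha' hf'

theorem norm_columnMap_le (h : IsIsolatedLevel D E b j) {a : SeqL1 n}
    (ha : 64 * ‖meanFreeSeq v s a‖ ≤ b) : ‖columnMap D j v s a‖ ≤ 2 := by
  obtain ⟨f, hf, he⟩ := exists_columnMap_eq h ha
  rw [he]
  exact norm_projColumn_le (hf.apply_self h ha) hf.norm_le

theorem norm_columnMap_sub_basis_le (h : IsIsolatedLevel D E b j) {a : SeqL1 n}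
    (ha : 64 * ‖meanFreeSeq v s a‖ ≤ b) :
    ‖columnMap D j v s a - SeqL1.basis j‖ ≤ 72 / b * ‖meanFreeSeq v s a‖ := by
  obtain ⟨f, hf, he⟩ := exists_columnMap_eq h ha
  have h1 := hf.norm_projColumn_sub_le h ha (by simpa using h.pos.le) (isState_basis h)
  rwa [projColumn_basis, sub_zero, ← he] at h1

/-- The columns for which the perturbation theory applies. -/
def IsAdmissible (v : SeqL1 n) (s R : ℝ) (a : SeqL1 n) : Prop :=
  ‖a‖ ≤ 2 ∧ ‖meanFreeSeq v s a‖ ≤ R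

/-- The smallness conditions under which the iteration converges at the rate `r / 2`. -/
structure IsSmallCoupling (b : ℝ) (v : SeqL1 n) (s R r : ℝ) : Prop where
  norm_le : ‖v‖ + 1 ≤ R
  gap : 64 * R ≤ b
  -- Here `4|s|` is the Lipschitz constant from columns to potentials and `72/b` the one back. The
  -- factor `R ≥ 1` lets the same inequality control the first step, whose size is `72R/b`.
  rate : 4 * |s| * (72 * R / b) ≤ r / 2
  rate_lt_one : r < 1

variable {r : ℝ}

theorem IsSmallCoupling.one_le (hc : IsSmallCoupling b v s R r) : 1 ≤ R := by
  linarith [hc.norm_le, norm_nonneg v]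

theorem IsAdmissible.small (hc : IsSmallCoupling b v s R r) {a : SeqL1 n}
    (ha : IsAdmissible v s R a) : 64 * ‖meanFreeSeq v s a‖ ≤ b := by
  linarith [hc.gap, ha.2]

theorem isAdmissible_basis (hc : IsSmallCoupling b v s R r) (j : Fin n → ℤ) :
    IsAdmissible v s R (SeqL1.basis j) :=
  ⟨by rw [SeqL1.norm_basis]; norm_num, by
    linarith [norm_meanFreeSeq_basis_le v s j, hc.norm_le]⟩

theorem norm_columnMap_sub_basis_le' (h : IsIsolatedLevel D E b j)
    (hc : IsSmallCoupling b v s R r) {a : SeqL1 n} (ha : IsAdmissible v s R a) :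
    ‖columnMap D j v s a - SeqL1.basis j‖ ≤ 72 * R / b := by
  have hb := h.pos
  refine (norm_columnMap_sub_basis_le h (ha.small hc)).trans ?_
  rw [mul_div_right_comm]
  gcongr
  exact ha.2

/-- The new column is within `72R/b` of `e_j`, so its mean-free potential is within `r/2 < 1` of
that of `e_j`, whose norm is at most `‖v‖`. The spare 1 in `‖v‖ + 1 ≤ R` covers this. -/
theorem IsAdmissible.columnMap (h : IsIsolatedLevel D E b j) (hc : IsSmallCoupling b v s R r)
    {a : SeqL1 n} (ha : IsAdmissible v s R a) : IsAdmissible v s R (columnMap D j v s a) := by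
  have h1 := norm_columnMap_le h (ha.small hc)
  refine ⟨h1, ?_⟩
  have h2 := norm_meanFreeSeq_sub_le v s h1 (isAdmissible_basis hc j).1
  have h3 : 4 * |s| * ‖Polyharmonic.columnMap D j v s a - SeqL1.basis j‖ ≤
      4 * |s| * (72 * R / b) := by
    gcongr
    exact norm_columnMap_sub_basis_le' h hc ha
  have h4 := norm_meanFreeSeq_basis_le v s j
  have h5 := norm_le_insert' (meanFreeSeq v s (Polyharmonic.columnMap D j v s a))
    (meanFreeSeq v s (SeqL1.basis j))
  linarith [hc.rate, hc.rate_lt_one, hc.norm_le]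

theorem norm_columnMap_sub_le' (h : IsIsolatedLevel D E b j) (hc : IsSmallCoupling b v s R r)
    {a a' : SeqL1 n} (ha : IsAdmissible v s R a) (ha' : IsAdmissible v s R a') :
    ‖columnMap D j v s a - columnMap D j v s a'‖ ≤ r / 2 * ‖a - a'‖ := by
  have hb := h.pos
  have h1 := norm_columnMap_sub_le h (ha.small hc) (ha'.small hc)
  have h2 := norm_meanFreeSeq_sub_le v s ha.1 ha'.1
  have h3 := hc.one_le
  calc _ ≤ 72 / b * (4 * |s| * ‖a - a'‖) := h1.trans (by gcongr)
    _ = 4 * |s| * (72 * 1 / b) * ‖a - a'‖ := by ring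
    _ ≤ 4 * |s| * (72 * R / b) * ‖a - a'‖ := by gcongr
    _ ≤ r / 2 * ‖a - a'‖ := by gcongr; exact hc.rate

/-- The iterates of `columnMap`. -/
def columnIter (D : (Fin n → ℤ) → ℝ) (j : Fin n → ℤ) (v : SeqL1 n) (s : ℝ) (m : ℕ) : SeqL1 n :=
  (columnMap D j v s)^[m] (SeqL1.basis j)

theorem columnIter_succ (D : (Fin n → ℤ) → ℝ) (j : Fin n → ℤ) (v : SeqL1 n) (s : ℝ) (m : ℕ) :
    columnIter D j v s (m + 1) = columnMap D j v s (columnIter D j v s m) :=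
  Function.iterate_succ_apply' _ _ _

theorem isAdmissible_columnIter (h : IsIsolatedLevel D E b j) (hc : IsSmallCoupling b v s R r)
    (m : ℕ) : IsAdmissible v s R (columnIter D j v s m) := by
  induction m with
  | zero => exact isAdmissible_basis hc j
  | succ m ih =>
    rw [columnIter_succ]
    exact ih.columnMap h hc

theorem IsSmallCoupling.nonneg (h : IsIsolatedLevel D E b j) (hc : IsSmallCoupling b v s R r) :
    0 ≤ r := by
  have h1 := h.pos
  have h2 := hc.one_le
  have h3 : 0 ≤ 4 * |s| * (72 * R / b) := by positivity
  linarith [hc.rate]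

theorem norm_columnIter_succ_sub_le (h : IsIsolatedLevel D E b j)
    (hc : IsSmallCoupling b v s R r) (m : ℕ) :
    ‖columnIter D j v s (m + 1) - columnIter D j v s m‖ ≤ 72 * R / b * (r / 2) ^ m := by
  induction m with
  | zero =>
    rw [columnIter_succ, pow_zero, mul_one]
    exact norm_columnMap_sub_basis_le' h hc (isAdmissible_basis hc j)
  | succ m ih =>
    have h0 := hc.nonneg h
    have h1 := norm_columnMap_sub_le' h hc (isAdmissible_columnIter h hc (m + 1))
      (isAdmissible_columnIter h hc m)
    rw [columnIter_succ, columnIter_succ D j v s m] at *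
    calc _ ≤ r / 2 * (72 * R / b * (r / 2) ^ m) := h1.trans (by gcongr)
      _ = _ := by ring

theorem exists_limit_columnIter (h : IsIsolatedLevel D E b j) (hc : IsSmallCoupling b v s R r) :
    ∃ a : SeqL1 n, ‖a‖ ≤ 2 ∧
      ∀ m, ‖a - columnIter D j v s m‖ ≤ 2 * (72 * R / b) * (r / 2) ^ m := by
  have h0 := hc.nonneg h
  have hr := hc.rate_lt_one
  have hd : ∀ m, dist (columnIter D j v s m) (columnIter D j v s (m + 1)) ≤
      72 * R / b * (r / 2) ^ m := fun m => by
    rw [dist_comm, dist_eq_norm]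
    exact norm_columnIter_succ_sub_le h hc m
  obtain ⟨a, ha⟩ := cauchySeq_tendsto_of_complete
    (cauchySeq_of_le_geometric (r / 2) (72 * R / b) (by linarith) hd)
  refine ⟨a, le_of_tendsto' ha.norm fun m => (isAdmissible_columnIter h hc m).1, fun m => ?_⟩
  have h1 := dist_le_of_le_geometric_of_tendsto (r / 2) (72 * R / b) (by linarith) hd ha m
  rw [dist_comm, dist_eq_norm] at h1
  refine h1.trans ?_
  have h2 := h.pos
  have h3 := hc.one_le
  -- The geometric series has sum `1/(1 - r/2) ≤ 2` because `r < 1`.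
  rw [div_le_iff₀ (by linarith)]
  have h4 : 0 ≤ 72 * R / b * (r / 2) ^ m := by positivity
  nlinarith

end

/-! ### Free eigenvalues near the non-resonant set -/

theorem pvec_sub_pvec (t τ : Space n) (m : Fin n → ℤ) : pvec t m - pvec τ m = t - τ := by
  ext i
  simp [pvec]

theorem abs_norm_pvec_sub_le (t τ : Space n) (m : Fin n → ℤ) :
    |‖pvec t m‖ - ‖pvec τ m‖| ≤ dist t τ := by
  rw [dist_eq_norm, ← pvec_sub_pvec t τ m]
  exact abs_norm_sub_norm_le _ _

/-- A point near the non-resonant set has exactly one free eigenvalue near `k²ˡ`. -/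
theorem exists_isIsolatedLevel {l : ℕ} {k δ : ℝ} {t : Space n} (hn : 2 ≤ n) (hl : n < 2 * l)
    (hδ : 0 < δ) (hk : 2 ≤ k) (hkδ : 4 * ((2 * l : ℕ) * 3 ^ (2 * l - 1)) ≤ k ^ δ)
    (ht : t ∈ nonresonantNhd n l k δ) :
    ∃ j, IsIsolatedLevel (freeLevel l t) (k ^ (2 * l)) (k ^ (2 * (l : ℝ) - n - δ)) j := by
  obtain ⟨-, ht⟩ := ht
  obtain ⟨τ, ⟨-, j, hj, hfar⟩, hdist⟩ := Metric.mem_thickening_iff.1 ht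
  have hk0 : 0 < k := by linarith
  have hk1 : 1 ≤ k := by linarith
  have hn' : (2 : ℝ) ≤ n := by exact_mod_cast hn
  set ρ := k ^ (-(n : ℝ) + 1 - 2 * δ) with hρ
  set b := k ^ (2 * (l : ℝ) - n - δ) with hb
  have hb0 : 0 < b := Real.rpow_pos_of_pos hk0 _
  have hρ0 : 0 < ρ := Real.rpow_pos_of_pos hk0 _
  have hρ1 : ρ ≤ 1 := Real.rpow_le_one_of_one_le_of_nonpos hk1 (by linarith)
  have hN : 1 ≤ 2 * l := by omega
  -- Moving the quasimomentum by `ρ` moves levels near `k²ˡ` by a multiple of `k^(2l-1) ρ = b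
  -- k^(-δ)`, and `k^δ` absorbs the constant.
  have hpow : k ^ (2 * l - 1) * ρ * k ^ δ = b := by
    rw [← Real.rpow_natCast, hρ, hb, ← Real.rpow_add hk0, ← Real.rpow_add hk0]
    congr 1
    push_cast [Nat.cast_sub hN]
    ring
  have hclose : ∀ m, ‖pvec τ m‖ ≤ 2 * k →
      |‖pvec t m‖ ^ (2 * l) - ‖pvec τ m‖ ^ (2 * l)| ≤ b / 4 := by
    intro m hm
    have h1 := (abs_norm_pvec_sub_le t τ m).trans hdist.le
    have h2 : max |‖pvec t m‖| |‖pvec τ m‖| ≤ 3 * k := by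
      rw [abs_norm, abs_norm]
      refine max_le ?_ (by linarith)
      have := (abs_le.1 h1).2
      linarith
    calc |‖pvec t m‖ ^ (2 * l) - ‖pvec τ m‖ ^ (2 * l)|
        ≤ |‖pvec t m‖ - ‖pvec τ m‖| * (2 * l : ℕ) *
          max |‖pvec t m‖| |‖pvec τ m‖| ^ (2 * l - 1) := abs_pow_sub_pow_le _ _ _
      _ ≤ ρ * (2 * l : ℕ) * (3 * k) ^ (2 * l - 1) := by gcongr
      _ = (2 * l : ℕ) * 3 ^ (2 * l - 1) * (k ^ (2 * l - 1) * ρ) := by rw [mul_pow]; ring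
      _ ≤ k ^ δ / 4 * (k ^ (2 * l - 1) * ρ) := by gcongr; linarith
      _ = b / 4 := by rw [← hpow]; ring
  refine ⟨j, hb0, ?_, fun m hm => ?_⟩
  · have hjk : ‖pvec τ j‖ = k :=
      (pow_left_inj₀ (norm_nonneg _) hk0.le (by omega)).1 hj
    rw [← hj]
    exact hclose j (by linarith)
  · rcases le_or_gt ‖pvec τ m‖ (2 * k) with h1 | h1
    · have h2 := hclose m h1
      have h3 := hfar m hm
      have h4 := abs_sub_le (‖pvec τ m‖ ^ (2 * l)) (‖pvec t m‖ ^ (2 * l)) (k ^ (2 * l))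
      rw [abs_sub_comm (‖pvec τ m‖ ^ (2 * l)) (‖pvec t m‖ ^ (2 * l))] at h4
      change 7 / 4 * b ≤ |‖pvec t m‖ ^ (2 * l) - k ^ (2 * l)|
      linarith
    · have h2 := (abs_le.1 ((abs_norm_pvec_sub_le t τ m).trans hdist.le)).1
      have h3 : 3 / 2 * k ≤ ‖pvec t m‖ := by linarith
      have h4 : (3 / 2 : ℝ) ^ 2 * k ^ (2 * l) ≤ ‖pvec t m‖ ^ (2 * l) := by
        calc (3 / 2 : ℝ) ^ 2 * k ^ (2 * l) ≤ (3 / 2 : ℝ) ^ (2 * l) * k ^ (2 * l) := by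
              gcongr
              · norm_num
              · omega
          _ = (3 / 2 * k) ^ (2 * l) := (mul_pow _ _ _).symm
          _ ≤ _ := by gcongr
      have h5 : 2 * b ≤ k ^ (2 * l) := by
        have : k * b ≤ k ^ (2 * l) := by
          rw [hb, ← Real.rpow_natCast, mul_comm, ← Real.rpow_add_one hk0.ne']
          refine Real.rpow_le_rpow_of_exponent_le hk1 ?_
          push_cast
          linarith
        nlinarith
      refine le_trans ?_ (le_abs_self _)
      change 7 / 4 * b ≤ ‖pvec t m‖ ^ (2 * l) - k ^ (2 * l)
      linarith

/-! ### The iteration -/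

theorem starNorm_eq_ofReal {W : Space n → ℝ} {w : SeqL1 n} (h : ∀ q, fourierCoef W q = w q) :
    starNorm W = ENNReal.ofReal ‖w‖ := by
  rw [starNorm, w.norm_eq, ← tsum_enorm_eq_ofReal w.summable_norm]
  simp only [h]

variable {l : ℕ} {k δ : ℝ} {t : Space n} {j : Fin n → ℤ} {V : Space n → ℝ} {v : SeqL1 n}
  {σ R r : ℝ} {A : ℂ}

theorem starNorm_wavePotential_sub_le (hV : MemLp V ∞ (cellMeasure n)) {a b : SeqL1 n}
    (ha : ‖a‖ ≤ 2) (hb : ‖b‖ ≤ 2) :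
    starNorm (wavePotential V σ A t a - wavePotential V σ A t b) ≤
      ENNReal.ofReal (4 * |σ * ‖A‖ ^ 2| * ‖a - b‖) := by
  -- `V` cancels in the difference, so 0 can stand for its coefficients, which need not be summable
  -- here.
  rw [starNorm_eq_ofReal (w := potentialSeq 0 (σ * ‖A‖ ^ 2) a - potentialSeq 0 (σ * ‖A‖ ^ 2) b)]
  · exact ENNReal.ofReal_le_ofReal (norm_potentialSeq_sub_le _ _ ha hb)
  · intro q
    rw [fourierCoef_sub (memLp_wavePotential hV _ _ _ _) (memLp_wavePotential hV _ _ _ _),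
      fourierCoef_wavePotential hV, fourierCoef_wavePotential hV, lp.coeFn_sub, Pi.sub_apply,
      potentialSeq_apply, potentialSeq_apply, add_sub_add_left_eq_sub, add_sub_add_left_eq_sub]

theorem fourierCoef_zeroMean_wavePotential (hV : MemLp V ∞ (cellMeasure n))
    (hv : fourierCoef V = v) (a : SeqL1 n) :
    fourierCoef (zeroMean (wavePotential V σ A t a)) = meanFreeSeq v (σ * ‖A‖ ^ 2) a := by
  funext q
  rw [fourierCoef_zeroMean (memLp_wavePotential hV _ _ _ _), fourierCoef_wavePotential hV,
    meanFreeSeq, SeqL1.meanFree_apply, hv, potentialSeq_apply]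

theorem isPerturbation_of_isAdmissible
    (h : IsIsolatedLevel (freeLevel l t) (k ^ (2 * l)) (k ^ (2 * (l : ℝ) - n - δ)) j)
    (hV : MemLp V ∞ (cellMeasure n)) (hv : fourierCoef V = v)
    (hc : IsSmallCoupling (k ^ (2 * (l : ℝ) - n - δ)) v (σ * ‖A‖ ^ 2) R r) {a : SeqL1 n}
    (ha : IsAdmissible v (σ * ‖A‖ ^ 2) R a) :
    IsPerturbation l k δ t j (zeroMean (wavePotential V σ A t a))
      (meanFreeSeq v (σ * ‖A‖ ^ 2) a) :=
  ⟨h, ha.small hc, memLp_zeroMean (memLp_wavePotential hV _ _ _ _),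
    fourierCoef_zeroMean_wavePotential hV hv a⟩

theorem projMatrix_eq_columnMap
    (h : IsIsolatedLevel (freeLevel l t) (k ^ (2 * l)) (k ^ (2 * (l : ℝ) - n - δ)) j)
    (hV : MemLp V ∞ (cellMeasure n)) (hv : fourierCoef V = v)
    (hc : IsSmallCoupling (k ^ (2 * (l : ℝ) - n - δ)) v (σ * ‖A‖ ^ 2) R r) {a : SeqL1 n}
    (ha : IsAdmissible v (σ * ‖A‖ ^ 2) R a) (m : Fin n → ℤ) :
    projMatrix l k δ t (zeroMean (wavePotential V σ A t a)) m j =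
      columnMap (freeLevel l t) j v (σ * ‖A‖ ^ 2) a m := by
  obtain ⟨f, hf, he⟩ := exists_columnMap_eq h (ha.small hc)
  rw [(isPerturbation_of_isAdmissible h hV hv hc ha).projMatrix_eq hf, he]

theorem iterateW_eq_wavePotential
    (h : IsIsolatedLevel (freeLevel l t) (k ^ (2 * l)) (k ^ (2 * (l : ℝ) - n - δ)) j)
    (hV : MemLp V ∞ (cellMeasure n)) (hv : fourierCoef V = v)
    (hc : IsSmallCoupling (k ^ (2 * (l : ℝ) - n - δ)) v (σ * ‖A‖ ^ 2) R r) (m : ℕ) :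
    iterateW l k δ t j V σ A m = wavePotential V σ A t
      (columnIter (freeLevel l t) j v (σ * ‖A‖ ^ 2) m) := by
  induction m with
  | zero =>
    funext x
    have h1 : waveSum t (SeqL1.basis j) x = planeWave t j x := by
      rw [waveSum, tsum_eq_single j]
      · simp [SeqL1.basis_apply]
      · intro m hm
        simp [SeqL1.basis_apply, hm]
    change V x + σ * ‖A‖ ^ 2 = V x + σ * ‖A * waveSum t (SeqL1.basis j) x‖ ^ 2
    rw [h1, norm_mul, norm_planeWave, mul_one]
  | succ m ih =>
    have h1 : iterateW l k δ t j V σ A (m + 1) =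
        nonlinearMap l k δ t j V σ A (iterateW l k δ t j V σ A m) :=
      Function.iterate_succ_apply' _ _ _
    rw [h1, ih]
    funext x
    simp only [nonlinearMap, blochFunction, wavePotential, waveSum, columnIter_succ,
      projMatrix_eq_columnMap h hV hv hc (isAdmissible_columnIter h hc m)]

/-- The successive approximations and their limit, for a small coupling. -/
theorem iterateW_converges
    (h : IsIsolatedLevel (freeLevel l t) (k ^ (2 * l)) (k ^ (2 * (l : ℝ) - n - δ)) j)
    (hper : IsCellPeriodic V) (hV : MemLp V ∞ (cellMeasure n)) (hv : fourierCoef V = v)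
    (hc : IsSmallCoupling (k ^ (2 * (l : ℝ) - n - δ)) v (σ * ‖A‖ ^ 2) R r) :
    (∀ m : ℕ, IsCellPeriodic (iterateW l k δ t j V σ A m) ∧
      MemLp (iterateW l k δ t j V σ A m) ∞ (cellMeasure n) ∧
      HasUniqueSimpleEigenvalue l k δ t (zeroMean (iterateW l k δ t j V σ A m)) ∧
      Summable fun q : Fin n → ℤ =>
        ‖projMatrix l k δ t (zeroMean (iterateW l k δ t j V σ A m)) q j‖) ∧
    (∀ m : ℕ, 1 ≤ m →
      starNorm (iterateW l k δ t j V σ A m - iterateW l k δ t j V σ A (m - 1)) ≤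
        ENNReal.ofReal (r ^ m)) ∧
    ∃ W : Space n → ℝ, IsCellPeriodic W ∧ MemLp W ∞ (cellMeasure n) ∧
      Filter.Tendsto (fun m => starNorm (W - iterateW l k δ t j V σ A m)) Filter.atTop
        (nhds 0) ∧
      ∀ m : ℕ, starNorm (W - iterateW l k δ t j V σ A m) ≤ ENNReal.ofReal (2 * r ^ (m + 1)) := by
  have hr0 := hc.nonneg h
  have hr1 := hc.rate_lt_one
  have hadm := isAdmissible_columnIter h hc
  simp only [iterateW_eq_wavePotential h hV hv hc]
  have hhalf : ∀ m : ℕ, (r / 2) ^ m ≤ r ^ m := fun m =>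
    pow_le_pow_left₀ (by linarith) (by linarith) m
  refine ⟨fun m => ⟨isCellPeriodic_wavePotential hper _ _ _ _, memLp_wavePotential hV _ _ _ _,
    ?_, ?_⟩, fun m hm => ?_, ?_⟩
  · obtain ⟨f, hf, -⟩ := exists_columnMap_eq h ((hadm m).small hc)
    exact (isPerturbation_of_isAdmissible h hV hv hc (hadm m)).hasUniqueSimpleEigenvalue hf
  · simp only [projMatrix_eq_columnMap h hV hv hc (hadm m)]
    exact SeqL1.summable_norm _
  · obtain ⟨m, rfl⟩ := Nat.exists_eq_add_of_le' hm
    rw [Nat.add_sub_cancel]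
    refine (starNorm_wavePotential_sub_le hV (hadm _).1 (hadm _).1).trans
      (ENNReal.ofReal_le_ofReal ?_)
    -- Passing from columns to potentials costs `4|s|`, which together with `72R/b` supplies one
    -- more factor `r/2`.
    calc _ ≤ 4 * |σ * ‖A‖ ^ 2| * (72 * R / k ^ (2 * (l : ℝ) - n - δ) * (r / 2) ^ m) := by
          gcongr
          exact norm_columnIter_succ_sub_le h hc m
      _ = 4 * |σ * ‖A‖ ^ 2| * (72 * R / k ^ (2 * (l : ℝ) - n - δ)) * (r / 2) ^ m := by ring
      _ ≤ r / 2 * (r / 2) ^ m := by gcongr; exact hc.rate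
      _ = (r / 2) ^ (m + 1) := (pow_succ' _ _).symm
      _ ≤ _ := hhalf _
  -- The limit potential is built from the limit column, so it is periodic and bounded by
  -- construction.
  · obtain ⟨a, ha, hlim⟩ := exists_limit_columnIter h hc
    have hbound : ∀ m : ℕ, starNorm (wavePotential V σ A t a - wavePotential V σ A t
        (columnIter (freeLevel l t) j v (σ * ‖A‖ ^ 2) m)) ≤ ENNReal.ofReal (2 * r ^ (m + 1)) := by
      intro m
      refine (starNorm_wavePotential_sub_le hV ha (hadm m).1).trans (ENNReal.ofReal_le_ofReal ?_)
      calc _ ≤ 4 * |σ * ‖A‖ ^ 2| *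
            (2 * (72 * R / k ^ (2 * (l : ℝ) - n - δ)) * (r / 2) ^ m) := by
            gcongr
            exact hlim m
        _ = 2 * (4 * |σ * ‖A‖ ^ 2| * (72 * R / k ^ (2 * (l : ℝ) - n - δ)) * (r / 2) ^ m) := by
            ring
        _ ≤ 2 * (r / 2 * (r / 2) ^ m) := by gcongr; exact hc.rate
        _ = 2 * (r / 2) ^ (m + 1) := by rw [pow_succ']
        _ ≤ _ := mul_le_mul_of_nonneg_left (hhalf _) zero_le_two
    refine ⟨wavePotential V σ A t a, isCellPeriodic_wavePotential hper _ _ _ _,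
      memLp_wavePotential hV _ _ _ _, ?_, hbound⟩
    have h1 : Filter.Tendsto (fun m : ℕ => 2 * r ^ (m + 1)) Filter.atTop (nhds 0) := by
      simpa using ((Filter.tendsto_add_atTop_iff_nat 1).2
        (tendsto_pow_atTop_nhds_zero_of_lt_one hr0 hr1)).const_mul 2
    have h2 := ENNReal.tendsto_ofReal h1
    rw [ENNReal.ofReal_zero] at h2
    exact tendsto_of_tendsto_of_tendsto_of_le_of_le tendsto_const_nhds h2
      (fun _ => zero_le) hbound

end Polyharmonic

end

/-! ### Choice of the threshold for `k`, and the theorem. -/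

open Polyharmonic in
theorem mainTheorem3 (n l : ℕ) (hn : 2 ≤ n) (hl : n < 2 * l) (δ : ℝ) (hδ : 0 < δ)
    (hδ' : 2 * δ < 2 * (l : ℝ) - n) (γ₀ : ℝ) (hγ₀ : γ₀ = 2 * (l : ℝ) - n - 2 * δ) (M : ℝ≥0) :
    ∃ k₁ : ℝ, ∀ V : Space n → ℝ, IsCellPeriodic V → MemLp V ∞ (cellMeasure n) →
      starNorm V = M → fourierCoef V 0 = 0 →
      ∀ k : ℝ, k₁ < k → ∀ t ∈ nonresonantNhd n l k δ,
      ∀ (σ : ℝ) (A : ℂ) (γ₁ : ℝ), γ₁ < γ₀ → |σ| * ‖A‖ ^ 2 < k ^ γ₁ →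
      ∃ j : Fin n → ℤ,
        (∀ i : Fin n → ℤ, ‖pvec t i‖ ^ (2 * l) ∈ energyWindow n l k δ ↔ i = j) ∧
        (∀ m : ℕ, IsCellPeriodic (iterateW l k δ t j V σ A m) ∧
          MemLp (iterateW l k δ t j V σ A m) ∞ (cellMeasure n) ∧
          HasUniqueSimpleEigenvalue l k δ t (zeroMean (iterateW l k δ t j V σ A m)) ∧
          Summable fun q : Fin n → ℤ =>
            ‖projMatrix l k δ t (zeroMean (iterateW l k δ t j V σ A m)) q j‖) ∧
        (∀ m : ℕ, 1 ≤ m →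
          starNorm (iterateW l k δ t j V σ A m - iterateW l k δ t j V σ A (m - 1)) ≤
            ENNReal.ofReal ((|σ| * ‖A‖ ^ 2 * k ^ (-γ₀)) ^ m)) ∧
        ∃ W : Space n → ℝ, IsCellPeriodic W ∧ MemLp W ∞ (cellMeasure n) ∧
          Filter.Tendsto (fun m => starNorm (W - iterateW l k δ t j V σ A m)) Filter.atTop
            (nhds 0) ∧
          ∀ m : ℕ, starNorm (W - iterateW l k δ t j V σ A m) ≤
            ENNReal.ofReal (2 * (|σ| * ‖A‖ ^ 2 * k ^ (-γ₀)) ^ (m + 1)) := by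
  set R : ℝ := M + 1 with hR
  have hM : (0 : ℝ) ≤ M := M.2
  -- The first constant is the one of `exists_isIsolatedLevel`; `576 = 2·4·72` gives the rate `r/2`.
  -- Only `l`, `δ` and `M` enter.
  obtain ⟨k₀, hk₀⟩ := Filter.eventually_atTop.1 ((Filter.eventually_ge_atTop (2 : ℝ)).and
    ((tendsto_rpow_atTop hδ).eventually_ge_atTop
      (4 * ((2 * l : ℕ) * 3 ^ (2 * l - 1)) + 576 * R)))
  refine ⟨k₀, fun V hper hV hVM _ k hk t ht σ A γ₁ hγ₁ hσ => ?_⟩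
  obtain ⟨hk2, hkδ⟩ := hk₀ k hk.le
  have hk0 : 0 < k := by linarith
  have hC : (0 : ℝ) ≤ 4 * ((2 * l : ℕ) * 3 ^ (2 * l - 1)) := by positivity
  obtain ⟨j, h⟩ := exists_isIsolatedLevel hn hl hδ hk2 (by linarith) ht
  have hs : Summable fun q => ‖fourierCoef V q‖ := by
    rw [summable_norm_iff_tsum_enorm]
    exact ne_of_eq_of_ne hVM ENNReal.coe_ne_top
  have hnorm : ‖SeqL1.mk (fourierCoef V) hs‖ = M := by
    have h1 := starNorm_eq_ofReal (W := V) (w := SeqL1.mk (fourierCoef V) hs) fun _ => rfl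
    rw [hVM, ← ENNReal.ofReal_coe_nnreal,
      ENNReal.ofReal_eq_ofReal_iff hM (norm_nonneg _)] at h1
    exact h1.symm
  set b := k ^ (2 * (l : ℝ) - n - δ) with hb
  have hb0 : 0 < b := h.pos
  -- Since `2δ < 2l - n`, the window exponent is at least `δ`; so `64R ≤ b` follows from the bound
  -- on `k^δ`.
  have hbδ : k ^ δ ≤ b := Real.rpow_le_rpow_of_exponent_le (by linarith) (by linarith)
  -- The exponent `γ₀` is smaller by `δ` than that of the window; this spare `k^δ` pays for all
  -- numerical constants.
  have hγ : k ^ (-γ₀) = k ^ δ / b := by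
    rw [hb, ← Real.rpow_sub hk0, hγ₀]
    congr 1
    ring
  have habs : |σ * ‖A‖ ^ 2| = |σ| * ‖A‖ ^ 2 := by
    rw [abs_mul, abs_of_nonneg (by positivity : 0 ≤ ‖A‖ ^ 2)]
  have hc : IsSmallCoupling b (SeqL1.mk (fourierCoef V) hs) (σ * ‖A‖ ^ 2) R
      (|σ| * ‖A‖ ^ 2 * k ^ (-γ₀)) := by
    refine ⟨by rw [hnorm], by linarith, ?_, ?_⟩
    · rw [habs, hγ]
      calc 4 * (|σ| * ‖A‖ ^ 2) * (72 * R / b) = |σ| * ‖A‖ ^ 2 * (576 * R / b) / 2 := by ring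
        _ ≤ |σ| * ‖A‖ ^ 2 * (k ^ δ / b) / 2 := by gcongr; linarith
    · calc |σ| * ‖A‖ ^ 2 * k ^ (-γ₀) < k ^ γ₁ * k ^ (-γ₀) := by gcongr
        _ = k ^ (γ₁ - γ₀) := by rw [← Real.rpow_add hk0, sub_eq_add_neg]
        _ ≤ 1 := Real.rpow_le_one_of_one_le_of_nonpos (by linarith) (by linarith)
  refine ⟨j, fun i => ?_, iterateW_converges h hper hV rfl hc⟩
  rw [mem_energyWindow_iff]
  constructor
  · intro hi
    by_contra hne
    have h1 : 7 / 4 * b ≤ |‖pvec t i‖ ^ (2 * l) - k ^ (2 * l)| := h.far i hne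
    linarith
  · rintro rfl
    have h1 : |‖pvec t i‖ ^ (2 * l) - k ^ (2 * l)| ≤ b / 4 := h.near
    linarith
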